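/- Let $H(2,1)$ be the Lie group of real matrices $\begin{pmatrix}1&x_1&x_2&z\\0&1&0&y_1\\0&0&1&y_2\\0&0&0&1\end{pmatrix}$, $\Gamma(2,1)$ its subgroup of matrices with integer entries, and $N=N(2,1)=\Gamma(2,1)\backslash H(2,1)$, a 5-dimensional nilmanifold. Let $a,b,c,\lambda,\mu,\tau\in\mathbb R$ satisfy $$0<\lambda^2+\mu^2+\tau^2<\tfrac38(a^2+b^2+c^2)$$ (so $(a,b,c)\neq 0$). Consider coframes $e^1,\dots,e^5$ on $N$ that are induced by left-invariant 1-forms on $H(2,1)$ and satisfy $$de^1=de^2=de^3=de^4=0,\qquad de^5=a(e^{12}-e^{34})+b(e^{13}+e^{24})+c(e^{14}-e^{23}).$$ Such a coframe exists: for $a^2+b^2\ne0$ one is induced by $e^1=(a^2+b^2+c^2)dx_1$, $e^2=a\,dy_1+b(1+\frac{c^2}{a^2+b^2})dx_2-ac\,dy_2$, $e^3=b\,dy_1-a(1+\frac{c^2}{a^2+b^2})dx_2-bc\,dy_2$, $e^4=c\,dy_1+(a^2+b^2)dy_2$, $e^5=(a^2+b^2+c^2)^2(x_1dy_1+x_2dy_2-dz)$,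 and for $a=b=0$, $c\neq0$ one is induced by $dx_1$, $dx_2$, $-dy_2$, $dy_1$, $c(x_1dy_1+x_2dy_2-dz)$. For every such coframe, with dual frame $E_1,\dots,E_5$, put $\eta=e^5$, $\xi=E_5$, $F_1=e^{12}+e^{34}$, $F_2=e^{13}+e^{42}$, $F_3=e^{14}+e^{23}$, $g=\sum_i e^i\otimes e^i$, let $\psi$ be defined by $g(X,\psi Y)=F_1(X,Y)$, and let $T=\eta\wedge d\eta$. Then $(\eta,F_1,F_2,F_3)$ is an $SU(2)$-structure on $N$; write $N_{a,b,c}$ for $N$ with it. For a linear connection $\nabla$ on $N$ with $\nabla_XE_j=\sum_i\omega^i_j(X)E_i$ put $\Omega^i_j=d\omega^i_j+\sum_k\omega^i_k\wedge\omega^k_j$ and $p_1(\nabla)=\frac1{8\pi^2}\sum_{i<j}\Omega^i_j\wedge\Omega^i_j$. Let $\nabla^g$ be the Levi-Civita connection of $g$, $\nabla^+=\nabla^g+\frac12T$, and let $A=A_{\lambda,\mu,\tau}$ be the linear connection with connection forms $\sigma^1_2=-\sigma^2_1=-\sigma^3_4=\sigma^4_3=-\lambda e^5$, $\sigma^1_3=-\sigma^3_1=\sigma^2_4=-\sigma^4_2=-\mu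 e^5$, $\sigma^1_4=-\sigma^4_1=-\sigma^2_3=\sigma^3_2=-\tau e^5$, and $\sigma^i_j=0$ otherwise. Then $$dT=2\pi^2\alpha'\,\bigl(p_1(\nabla^g)-p_1(A)\bigr),\qquad \alpha'=\frac{16}{3(a^2+b^2+c^2)-8(\lambda^2+\mu^2+\tau^2)}>0 .$$ Moreover $(N_{a,b,c},A,\nabla^g)$ is a compact solution of the supersymmetry equations with flux $H=T\ne0$ and constant dilaton, satisfying the anomaly cancellation condition with respect to $\nabla^g$. That is: $N$ is compact; $dF_1=dF_2=dF_3=0$ and $*_{\mathbb H}d\eta=-d\eta$ on $\mathbb H=\ker\eta$; the curvature forms $\Omega$ of $A$ satisfy $\Omega^i_j(\psi E_k,\psi E_l)=\Omega^i_j(E_k,E_l)$ and $\sum_k\Omega^i_j(E_k,\psi E_k)=0$; and for every constant dilaton $\phi$ there is a smooth nowhere vanishing spinor field $\varepsilon$ (for the spin structure given by the frame $E_i$ and Clifford multiplication with $E_i\cdot E_i=-1$, $E_1\cdot E_2\cdot E_3\cdot E_4\cdot E_5=-\sqrt{-1}$) which defines the structure, i.e. $\xi\cdot\varepsilon=\sqrt{-1}\,\varepsilon$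 and $-2\psi X\cdot\varepsilon+\xi\cdot X\cdot\varepsilon=\sqrt{-1}\,X\cdot\varepsilon$ for all $X$, and which satisfies $$\nabla^+\varepsilon=0,\qquad (d\phi-\tfrac12T)\cdot\varepsilon=0,\qquad \Omega^i_j\cdot\varepsilon=0\ \text{ for all } i,j .$$ -/

import Mathlib

open scoped Manifold ContDiff Topology

noncomputable section

namespace HeisNil

/-! ## The group `H(2,1)`, the lattice `Γ(2,1)` and the nilmanifold `N(2,1)` -/

/-- The group `H(2,1)` in its global coordinates `(x₁, x₂, y₁, y₂, z) = (p 0, p 1, p 2, p 3, p 4)`;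
the group structure is the one of the matrices `heisMatrix p`. -/
abbrev H21 : Type := EuclideanSpace ℝ (Fin 5)

/-- The unipotent matrix with coordinates `p`. -/
def heisMatrix (p : H21) : Matrix (Fin 4) (Fin 4) ℝ :=
  !![1, p 0, p 1, p 4;
     0, 1, 0, p 2;
     0, 0, 1, p 3;
     0, 0, 0, 1]

/-- The product of `H(2,1)`, see `heisMatrix_mul`. -/
def heisMul (p q : H21) : H21 :=
  !₂[p 0 + q 0, p 1 + q 1, p 2 + q 2, p 3 + q 3, p 4 + q 4 + p 0 * q 2 + p 1 * q 3]

/-- The inverse of `H(2,1)`. -/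
def heisInv (p : H21) : H21 :=
  !₂[-p 0, -p 1, -p 2, -p 3, -p 4 + p 0 * p 2 + p 1 * p 3]

instance : Group H21 where
  mul := heisMul
  one := 0
  inv := heisInv
  mul_assoc p q r := by
    change heisMul (heisMul p q) r = heisMul p (heisMul q r)
    ext i; fin_cases i <;> simp [heisMul] <;> ring
  one_mul p := by
    change heisMul 0 p = p
    ext i; fin_cases i <;> simp [heisMul]
  mul_one p := by
    change heisMul p 0 = p
    ext i; fin_cases i <;> simp [heisMul]
  inv_mul_cancel p := by
    change heisMul (heisInv p) p = 0
    ext i; fin_cases i <;> simp [heisMul, heisInv]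
    ring

theorem mul_def (p q : H21) : p * q =
    !₂[p 0 + q 0, p 1 + q 1, p 2 + q 2, p 3 + q 3, p 4 + q 4 + p 0 * q 2 + p 1 * q 3] := rfl

theorem inv_def (p : H21) : p⁻¹ =
    !₂[-p 0, -p 1, -p 2, -p 3, -p 4 + p 0 * p 2 + p 1 * p 3] := rfl

theorem one_def : (1 : H21) = 0 := rfl

/-- The group law is matrix multiplication. -/
theorem heisMatrix_mul (p q : H21) : heisMatrix (p * q) = heisMatrix p * heisMatrix q := by
  ext i j
  fin_cases i <;> fin_cases j <;>
    simp [heisMatrix, mul_def, Matrix.mul_apply, Fin.sum_univ_four] <;> ring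

/-- The subgroup `Γ(2,1)` of the matrices with integer entries. -/
def latticeΓ : Subgroup H21 where
  carrier := {p | ∀ i, ∃ n : ℤ, p i = n}
  mul_mem' {p q} hp hq := by
    choose m hm using hp
    choose n hn using hq
    intro i
    fin_cases i
    · exact ⟨m 0 + n 0, by simp [mul_def, hm, hn]⟩
    · exact ⟨m 1 + n 1, by simp [mul_def, hm, hn]⟩
    · exact ⟨m 2 + n 2, by simp [mul_def, hm, hn]⟩
    · exact ⟨m 3 + n 3, by simp [mul_def, hm, hn]⟩
    · exact ⟨m 4 + n 4 + m 0 * n 2 + m 1 * n 3, by simp [mul_def, hm, hn]⟩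
  one_mem' i := ⟨0, by simp [one_def]⟩
  inv_mem' {p} hp := by
    choose m hm using hp
    intro i
    fin_cases i
    · exact ⟨-m 0, by simp [inv_def, hm]⟩
    · exact ⟨-m 1, by simp [inv_def, hm]⟩
    · exact ⟨-m 2, by simp [inv_def, hm]⟩
    · exact ⟨-m 3, by simp [inv_def, hm]⟩
    · exact ⟨-m 4 + m 0 * m 2 + m 1 * m 3, by simp [inv_def, hm]⟩

theorem contDiff_mul : ContDiff ℝ ∞ fun x : H21 × H21 => x.1 * x.2 := by
  rw [contDiff_euclidean]
  intro i
  have h1 (j : Fin 5) : ContDiff ℝ ∞ fun x : H21 × H21 => x.1 j :=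
    (contDiff_euclidean.1 contDiff_fst) j
  have h2 (j : Fin 5) : ContDiff ℝ ∞ fun x : H21 × H21 => x.2 j :=
    (contDiff_euclidean.1 contDiff_snd) j
  fin_cases i <;> simp only [mul_def] <;> simp <;> fun_prop

theorem contDiff_inv : ContDiff ℝ ∞ fun x : H21 => x⁻¹ := by
  rw [contDiff_euclidean]
  intro i
  have h1 (j : Fin 5) : ContDiff ℝ ∞ fun x : H21 => x j :=
    (contDiff_euclidean.1 contDiff_id) j
  fin_cases i <;> simp only [inv_def] <;> simp <;> fun_prop

theorem contDiff_mul_left (g : H21) : ContDiff ℝ ∞ fun x : H21 => g * x :=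
  contDiff_mul.comp (contDiff_const.prodMk contDiff_id)

instance : IsTopologicalGroup H21 where
  continuous_mul := contDiff_mul.continuous
  continuous_inv := contDiff_inv.continuous

instance : ProperlyDiscontinuousSMul latticeΓ H21 := by
  apply Subgroup.properlyDiscontinuousSMul_of_tendsto_cofinite
  intro s hs
  obtain ⟨K, hK, hKs⟩ := Filter.mem_cocompact.1 hs
  obtain ⟨R, hR⟩ := hK.isBounded.exists_norm_le
  rw [Filter.mem_map, Filter.mem_cofinite]
  have hint (γ : latticeΓ) : ∃ n : Fin 5 → ℤ, ∀ i, (γ : H21) i = n i := ⟨_, fun i =>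
    (γ.2 i).choose_spec⟩
  choose n hn using hint
  have hinj : Function.Injective n := by
    intro γ γ' h
    apply Subtype.ext
    ext i
    rw [hn, hn, h]
  refine Set.Finite.of_finite_image (f := n) ?_ hinj.injOn
  refine (Set.finite_Icc (fun _ : Fin 5 => -⌈R⌉) (fun _ => ⌈R⌉)).subset ?_
  rintro _ ⟨γ, hγ, rfl⟩
  have hγK : (γ : H21) ∈ K := by
    by_contra hc
    exact hγ (hKs hc)
  have hb (i : Fin 5) : |(n γ i : ℝ)| ≤ (⌈R⌉ : ℝ) := by
    rw [← hn, ← Real.norm_eq_abs]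
    exact ((PiLp.norm_apply_le _ i).trans (hR _ hγK)).trans (Int.le_ceil R)
  exact ⟨fun i => by have := (abs_le.1 (hb i)).1; exact_mod_cast this,
    fun i => by have := (abs_le.1 (hb i)).2; exact_mod_cast this⟩

/-- The nilmanifold `N(2,1) = Γ(2,1) \ H(2,1)`, the quotient by left translations, with Mathlib's
quotient topology and quotient charts. -/
abbrev N21 : Type := MulAction.orbitRel.Quotient latticeΓ H21

/-- The projection `H(2,1) → N(2,1)`. -/
def proj (h : H21) : N21 := Quotient.mk _ h

theorem proj_eq_iff (h h' : H21) : proj h = proj h' ↔ ∃ γ : latticeΓ, (γ : H21) * h' = h := by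
  unfold proj
  rw [Quotient.eq]
  rfl

theorem exists_of_mem_atlas {c : OpenPartialHomeomorph N21 H21} (hc : c ∈ atlas H21 N21) :
    ∀ y, c.symm y = proj y := by
  obtain ⟨q, rfl⟩ := hc
  intro y
  simp [proj, chartAt_self_eq]

instance : IsManifold 𝓘(ℝ, H21) ∞ N21 := by
  apply isManifold_of_contDiffOn
  intro c c' hc hc'
  simp only [modelWithCornersSelf_coe, modelWithCornersSelf_coe_symm, Set.range_id,
    Set.inter_univ, Function.comp_id, Function.id_comp, Set.preimage_id]
  intro y hy
  have hs := exists_of_mem_atlas hc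
  have hs' := exists_of_mem_atlas hc'
  set f := c.symm ≫ₕ c' with hf
  have hsub : ∀ x ∈ f.source, f x ∈ c'.target ∧ proj (f x) = proj x := by
    intro x hx
    have hx1 : c.symm x ∈ c'.source := by
      have := hx
      simp only [hf, OpenPartialHomeomorph.trans_source, Set.mem_inter_iff] at this
      exact this.2
    have hfx : f x = c' (c.symm x) := rfl
    refine ⟨hfx ▸ c'.map_source hx1, ?_⟩
    rw [hfx, ← hs', c'.left_inv hx1, hs]
  obtain ⟨γ, hγ⟩ := (proj_eq_iff _ _).1 (hsub y hy).2
  have hcont : Continuous fun x : H21 => (γ : H21) * x := (contDiff_mul_left _).continuous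
  have hev : ∀ᶠ x in 𝓝 y, f x = (γ : H21) * x := by
    have h1 : ∀ᶠ x in 𝓝 y, (γ : H21) * x ∈ c'.target :=
      hcont.continuousAt.eventually_mem
        (c'.open_target.mem_nhds (by rw [hγ]; exact (hsub y hy).1))
    have h2 : ∀ᶠ x in 𝓝 y, x ∈ f.source := f.open_source.mem_nhds hy
    filter_upwards [h1, h2] with x hx1 hx2
    apply c'.symm.injOn (hsub x hx2).1 hx1
    rw [hs', hs', (hsub x hx2).2]
    exact ((proj_eq_iff _ _).2 ⟨γ, rfl⟩).symm
  exact ((contDiff_mul_left (γ : H21)).contDiffAt.congr_of_eventuallyEq hev).contDiffWithinAt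

/-! ## Differential forms on `N(2,1)` -/

/-- The tangent space of `N(2,1)` at `p`. -/
abbrev TN (p : N21) : Type := TangentSpace 𝓘(ℝ, H21) p

/-- Vector fields on `N(2,1)`. -/
abbrev VField : Type := ∀ p : N21, TN p

/-- Differential `k`-forms on `N(2,1)`. -/
abbrev NForm (k : ℕ) : Type := ∀ p : N21, TN p [⋀^Fin k]→L[ℝ] ℝ

section Wedge

variable {V : Type} [AddCommGroup V] [Module ℝ V] [TopologicalSpace V] {k l : ℕ}

theorem update_castAdd_left {W : Type} (m : Fin (k + l) → W) (i : Fin k) (x : W) :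
    (fun i' => Function.update m (Fin.castAdd l i) x (Fin.castAdd l i')) =
      Function.update (fun i' => m (Fin.castAdd l i')) i x :=
  Function.update_comp_eq_of_injective m (Fin.castAdd_injective k l) i x

theorem update_castAdd_right {W : Type} (m : Fin (k + l) → W) (i : Fin k) (x : W) :
    (fun j => Function.update m (Fin.castAdd l i) x (Fin.natAdd k j)) =
      fun j => m (Fin.natAdd k j) := by
  funext j
  apply Function.update_of_ne
  intro h
  have := congrArg Fin.val h
  simp at this
  omega

theorem update_natAdd_left {W : Type} (m : Fin (k + l) → W) (j : Fin l) (x : W) :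
    (fun i => Function.update m (Fin.natAdd k j) x (Fin.castAdd l i)) =
      fun i => m (Fin.castAdd l i) := by
  funext i
  apply Function.update_of_ne
  intro h
  have := congrArg Fin.val h
  simp at this
  omega

theorem update_natAdd_right {W : Type} (m : Fin (k + l) → W) (j : Fin l) (x : W) :
    (fun j' => Function.update m (Fin.natAdd k j) x (Fin.natAdd k j')) =
      Function.update (fun j' => m (Fin.natAdd k j')) j x :=
  Function.update_comp_eq_of_injective m (Fin.natAdd_injective l k) j x

/-- The tensor product of two alternating forms,
`(v₁, …, v_{k+l}) ↦ α (v₁, …, v_k) * β (v_{k+1}, …, v_{k+l})`. -/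
def tensorMul (α : V [⋀^Fin k]→L[ℝ] ℝ) (β : V [⋀^Fin l]→L[ℝ] ℝ) :
    ContinuousMultilinearMap ℝ (fun _ : Fin (k + l) => V) ℝ where
  toFun v := α (fun i => v (Fin.castAdd l i)) * β (fun j => v (Fin.natAdd k j))
  map_update_add' {inst} m i x y := by
    obtain rfl : inst = instDecidableEqFin _ := Subsingleton.elim _ _
    induction i using Fin.addCases with
    | left i =>
      simp only [update_castAdd_left, update_castAdd_right, ContinuousAlternatingMap.map_update_add,
        add_mul]
    | right j =>
      simp only [update_natAdd_left, update_natAdd_right, ContinuousAlternatingMap.map_update_add,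
        mul_add]
  map_update_smul' {inst} m i c x := by
    obtain rfl : inst = instDecidableEqFin _ := Subsingleton.elim _ _
    induction i using Fin.addCases with
    | left i =>
      simp only [update_castAdd_left, update_castAdd_right,
        ContinuousAlternatingMap.map_update_smul, smul_eq_mul, mul_assoc]
    | right j =>
      simp only [update_natAdd_left, update_natAdd_right,
        ContinuousAlternatingMap.map_update_smul, smul_eq_mul, mul_left_comm]
  cont := (α.cont.comp (by fun_prop)).mul (β.cont.comp (by fun_prop))

/-- The wedge product, normalised so that for 1-forms
`(α ∧ β) (v, w) = α v * β w - α w * β v`. -/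
def wedge (α : V [⋀^Fin k]→L[ℝ] ℝ) (β : V [⋀^Fin l]→L[ℝ] ℝ) : V [⋀^Fin (k + l)]→L[ℝ] ℝ :=
  ((k.factorial : ℝ) * (l.factorial : ℝ))⁻¹ •
    ContinuousMultilinearMap.alternatization (tensorMul α β)

end Wedge

/-- The wedge product of differential forms on `N(2,1)`. -/
def NForm.wedge {k l : ℕ} (α : NForm k) (β : NForm l) : NForm (k + l) :=
  fun p => HeisNil.wedge (α p) (β p)

/-- The exterior derivative of a form on `N(2,1)`: read the form in the preferred chart at `p`, take
the exterior derivative there, and go back to the tangent space at `p`. -/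
def NForm.d {k : ℕ} (α : NForm k) : NForm (k + 1) := fun p =>
  (extDeriv (fun y : H21 =>
      ((α ((extChartAt 𝓘(ℝ, H21) p).symm y)).compContinuousLinearMap
        (mfderiv 𝓘(ℝ, H21) 𝓘(ℝ, H21) (extChartAt 𝓘(ℝ, H21) p).symm y) :
          H21 [⋀^Fin k]→L[ℝ] ℝ))
    (extChartAt 𝓘(ℝ, H21) p p)).compContinuousLinearMap
      (mfderiv 𝓘(ℝ, H21) 𝓘(ℝ, H21) (extChartAt 𝓘(ℝ, H21) p) p)

/-- The pull-back of a form on `N(2,1)` to `H(2,1)`. -/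
def NForm.pull {k : ℕ} (α : NForm k) (h : H21) : H21 [⋀^Fin k]→L[ℝ] ℝ :=
  (α (proj h)).compContinuousLinearMap (mfderiv 𝓘(ℝ, H21) 𝓘(ℝ, H21) proj h)

/-- Left invariance of a form on `H(2,1)`. -/
def IsLeftInvariant {k : ℕ} (θ : H21 → H21 [⋀^Fin k]→L[ℝ] ℝ) : Prop :=
  ∀ g h : H21, (θ (g * h)).compContinuousLinearMap (fderiv ℝ (fun x : H21 => g * x) h) = θ h

/-- The 1-form on `N(2,1)` given by a field of linear functionals. -/
def oneForm (f : ∀ p : N21, TN p →L[ℝ] ℝ) : NForm 1 := fun p =>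
  ContinuousAlternatingMap.ofSubsingleton ℝ (TN p) ℝ (0 : Fin 1) (f p)

/-! ## Coframes, and the family of coframes that defines `N(2,1)_{a,b,c}`

The 1-forms written `e^1, …, e^5` are `e 0, …, e 4`. -/

/-- The coframe `e` is, at each point, a basis of the cotangent space. -/
def IsCoframe (e : Fin 5 → NForm 1) : Prop :=
  ∀ p, Function.Bijective fun (v : TN p) (i : Fin 5) => e i p ![v]

/-- The frame `E_1, …, E_5` dual to a coframe. -/
def frame (e : Fin 5 → NForm 1) (i : Fin 5) : VField := fun p =>
  Function.invFun (fun (v : TN p) (j : Fin 5) => e j p ![v]) (Pi.single i 1)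

/-- The 2-form `e^i ∧ e^j`. -/
def e₂ (e : Fin 5 → NForm 1) (i j : Fin 5) : NForm 2 := (e i).wedge (e j)

/-- A coframe on `N(2,1)` that comes from left-invariant forms on `H(2,1)` and satisfies
`de^1 = de^2 = de^3 = de^4 = 0`,
`de^5 = a (e^{12} - e^{34}) + b (e^{13} + e^{24}) + c (e^{14} - e^{23})`. -/
structure IsNilCoframe (a b c : ℝ) (e : Fin 5 → NForm 1) : Prop where
  isCoframe : IsCoframe e
  leftInvariant : ∀ i, IsLeftInvariant (e i).pull
  d_horizontal : ∀ i, i ≠ 4 → (e i).d = 0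
  d_vertical : (e 4).d = a • (e₂ e 0 1 - e₂ e 2 3) + b • (e₂ e 0 2 + e₂ e 1 3)
    + c • (e₂ e 0 3 - e₂ e 1 2)

/-- The coordinate 1-forms `dx₁, dx₂, dy₁, dy₂, dz` on `H(2,1)`. -/
def dcoord (i : Fin 5) : H21 [⋀^Fin 1]→L[ℝ] ℝ :=
  ContinuousAlternatingMap.ofSubsingleton ℝ H21 ℝ (0 : Fin 1)
    (EuclideanSpace.proj i : H21 →L[ℝ] ℝ)

open Classical in
/-- The explicit left-invariant coframe on `H(2,1)` attached to `(a, b, c)`. -/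
def explicitCoframe (a b c : ℝ) : Fin 5 → H21 → H21 [⋀^Fin 1]→L[ℝ] ℝ :=
  if a ^ 2 + b ^ 2 ≠ 0 then
    ![fun _ => (a ^ 2 + b ^ 2 + c ^ 2) • dcoord 0,
      fun _ => a • dcoord 2 + (b * (1 + c ^ 2 / (a ^ 2 + b ^ 2))) • dcoord 1
        - (a * c) • dcoord 3,
      fun _ => b • dcoord 2 - (a * (1 + c ^ 2 / (a ^ 2 + b ^ 2))) • dcoord 1
        - (b * c) • dcoord 3,
      fun _ => c • dcoord 2 + (a ^ 2 + b ^ 2) • dcoord 3,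
      fun h => (a ^ 2 + b ^ 2 + c ^ 2) ^ 2 • (h 0 • dcoord 2 + h 1 • dcoord 3 - dcoord 4)]
  else
    ![fun _ => dcoord 0,
      fun _ => dcoord 1,
      fun _ => -dcoord 3,
      fun _ => dcoord 2,
      fun h => c • (h 0 • dcoord 2 + h 1 • dcoord 3 - dcoord 4)]

/-! ## The `SU(2)`-structure -/

/-- The contact form `η = e^5`. -/
def η (e : Fin 5 → NForm 1) : NForm 1 := e 4

/-- `F_1 = e^{12} + e^{34}`, `F_2 = e^{13} + e^{42}`, `F_3 = e^{14} + e^{23}`. -/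
def F (e : Fin 5 → NForm 1) : Fin 3 → NForm 2 :=
  ![e₂ e 0 1 + e₂ e 2 3, e₂ e 0 2 + e₂ e 3 1, e₂ e 0 3 + e₂ e 1 2]

/-- `SU(2)`-structures on a 5-manifold in the sense of Conti and Salamon. -/
structure IsSU2Structure (η : NForm 1) (F : Fin 3 → NForm 2) : Prop where
  volume : ∃ v : NForm 4, (∀ i j, (F i).wedge (F j) = if i = j then v else 0) ∧
    ∀ p, (v.wedge η) p ≠ 0
  positive : ∀ (p : N21) (X Y : TN p), (∀ Z, F 0 p ![X, Z] = F 1 p ![Y, Z]) → 0 ≤ F 2 p ![X, Y]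

/-- The metric `g = ∑ e^i ⊗ e^i`. -/
def metric (e : Fin 5 → NForm 1) (p : N21) (u v : TN p) : ℝ :=
  ∑ i, e i p ![u] * e i p ![v]

/-- The Hodge star of a 2-form on `ℍ = Ker η`, which is oriented by `e^{1234}`. -/
def hodgeH (e : Fin 5 → NForm 1) (β : NForm 2) : NForm 2 := fun p =>
  let B : Fin 5 → Fin 5 → ℝ := fun i j => β p ![frame e i p, frame e j p]
  B 0 1 • e₂ e 2 3 p - B 0 2 • e₂ e 1 3 p + B 0 3 • e₂ e 1 2 p
    + B 1 2 • e₂ e 0 3 p - B 1 3 • e₂ e 0 2 p + B 2 3 • e₂ e 0 1 p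

/-- The endomorphism `ψ` with `g (X, ψ Y) = F_1 (X, Y)`. -/
def ψ (e : Fin 5 → NForm 1) (p : N21) (Y : TN p) : TN p :=
  ∑ k, F e 0 p ![frame e k p, Y] • frame e k p

/-! ## Connections -/

/-- Linear connections on `N(2,1)`; `∇ Y p (X p)` is `(∇_X Y)_p`. -/
abbrev NConnection : Type :=
  CovariantDerivative 𝓘(ℝ, H21) H21 (fun p : N21 => TangentSpace 𝓘(ℝ, H21) p)

/-- Differentiability of a vector field at a point. -/
def VField.DiffAt (Y : VField) (p : N21) : Prop :=
  MDifferentiableAt 𝓘(ℝ, H21) (𝓘(ℝ, H21).prod 𝓘(ℝ, H21))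
    (fun q => (⟨q, Y q⟩ : TangentBundle 𝓘(ℝ, H21) N21)) p

/-- `∇` is the Levi-Civita connection of the metric `∑ e^i ⊗ e^i`: it is metric and torsion-free.
(Its value on vector fields that are not differentiable is irrelevant.) -/
structure IsLeviCivita (e : Fin 5 → NForm 1) (nabla : NConnection) : Prop where
  compatible : ∀ (p : N21) (Y Z : VField), Y.DiffAt p → Z.DiffAt p → ∀ X : TN p,
    mvfderiv 𝓘(ℝ, H21) (fun q => metric e q (Y q) (Z q)) p X =
      metric e p (nabla Y p X) (Z p) + metric e p (Y p) (nabla Z p X)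
  torsion_free : nabla.torsion = 0

/-- The connection 1-forms `θ^i_j` of `∇` in the frame dual to `e`: `∇_X E_j = ∑ θ^i_j(X) E_i`. -/
def connForm (e : Fin 5 → NForm 1) (nabla : NConnection) (i j : Fin 5) : NForm 1 := fun p =>
  (e i p).compContinuousLinearMap (nabla (frame e j) p)

/-- The curvature 2-forms `Ω^i_j = dθ^i_j + ∑ θ^i_k ∧ θ^k_j`. -/
def curvForm (θ : Fin 5 → Fin 5 → NForm 1) (i j : Fin 5) : NForm 2 :=
  (θ i j).d + ∑ k, (θ i k).wedge (θ k j)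

/-- The first Pontrjagin form `1/(8π²) ∑_{i<j} Ω^i_j ∧ Ω^i_j`. -/
def pontrjagin (θ : Fin 5 → Fin 5 → NForm 1) : NForm 4 :=
  (1 / (8 * Real.pi ^ 2)) •
    ∑ i : Fin 5, ∑ j ∈ Finset.Ioi i, (curvForm θ i j).wedge (curvForm θ i j)

/-- The torsion 3-form `T = η ∧ dη` (the flux `H`). -/
def torsion₃ (e : Fin 5 → NForm 1) : NForm 3 := (η e).wedge (η e).d

/-- The connection 1-forms of `∇ + ½ T`, that is, `θ^i_j (X) + ½ T(X, E_j, E_i)`. -/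
def plusForm (e : Fin 5 → NForm 1) (θ : Fin 5 → Fin 5 → NForm 1) (T : NForm 3) (i j : Fin 5) :
    NForm 1 :=
  θ i j + (1 / 2 : ℝ) • oneForm fun p =>
    (T p).toContinuousMultilinearMap.toContinuousLinearMap ![0, frame e j p, frame e i p] 0

/-- The coefficients of the connection 1-forms of `A_{λ,μ,τ}`: `σ^i_j = instantonCoeff i j • e^5`. -/
def instantonCoeff (l m t : ℝ) : Matrix (Fin 5) (Fin 5) ℝ :=
  !![0, -l, -m, -t, 0;
     l, 0, t, -m, 0;
     m, -t, 0, l, 0;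
     t, m, -l, 0, 0;
     0, 0, 0, 0, 0]

/-- `A` is the linear connection `A_{λ,μ,τ}`. -/
def IsInstantonA (e : Fin 5 → NForm 1) (l m t : ℝ) (A : NConnection) : Prop :=
  ∀ i j, connForm e A i j = instantonCoeff l m t i j • e 4

/-- The `SU(2)`-instanton condition on curvature 2-forms:
`Ω(ψ E_k, ψ E_l) = Ω(E_k, E_l)` and `∑ Ω(E_k, ψ E_k) = 0`. -/
def IsSU2Instanton (e : Fin 5 → NForm 1) (Ω : Fin 5 → Fin 5 → NForm 2) : Prop :=
  ∀ i j p,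
    (∀ k l, Ω i j p ![ψ e p (frame e k p), ψ e p (frame e l p)] =
      Ω i j p ![frame e k p, frame e l p]) ∧
    ∑ k, Ω i j p ![frame e k p, ψ e p (frame e k p)] = 0

/-! ## Spinors and the supersymmetry equations -/

open Complex in
/-- Clifford multiplication by `E_1, …, E_5` on the 5-dimensional spinor module `ℂ⁴`. -/
def γ : Fin 5 → Matrix (Fin 4) (Fin 4) ℂ :=
  ![!![0, 0, I, 0; 0, 0, 0, I; I, 0, 0, 0; 0, I, 0, 0],
    !![0, 0, 1, 0; 0, 0, 0, 1; -1, 0, 0, 0; 0, -1, 0, 0],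
    !![0, I, 0, 0; I, 0, 0, 0; 0, 0, 0, -I; 0, 0, -I, 0],
    !![0, 1, 0, 0; -1, 0, 0, 0; 0, 0, 0, -1; 0, 0, 1, 0],
    !![I, 0, 0, 0; 0, -I, 0, 0; 0, 0, -I, 0; 0, 0, 0, I]]

set_option maxHeartbeats 1000000 in
/-- The Clifford relations `E_i · E_j + E_j · E_i = -2 δ_{ij}`. -/
theorem γ_clifford (i j : Fin 5) :
    γ i * γ j + γ j * γ i = if i = j then (-2 : ℂ) • (1 : Matrix (Fin 4) (Fin 4) ℂ) else 0 := by
  fin_cases i <;> fin_cases j <;> simp [γ] <;> ext k l <;> fin_cases k <;> fin_cases l <;>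
    simp <;> norm_num

/-- Spinor fields, in the trivialisation of the spinor bundle by the frame dual to `e`. -/
abbrev Spinor : Type := N21 → Fin 4 → ℂ

/-- Clifford multiplication by a tangent vector. -/
def cliffVec (e : Fin 5 → NForm 1) (p : N21) (X : TN p) : Matrix (Fin 4) (Fin 4) ℂ :=
  ∑ i, ((e i p ![X] : ℝ) : ℂ) • γ i

/-- The Clifford action of a 1-form. -/
def cliff₁ (e : Fin 5 → NForm 1) (α : NForm 1) (p : N21) : Matrix (Fin 4) (Fin 4) ℂ :=
  ∑ i, ((α p ![frame e i p] : ℝ) : ℂ) • γ i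

/-- The Clifford action of a 2-form. -/
def cliff₂ (e : Fin 5 → NForm 1) (β : NForm 2) (p : N21) : Matrix (Fin 4) (Fin 4) ℂ :=
  (1 / 2 : ℂ) • ∑ i, ∑ j, ((β p ![frame e i p, frame e j p] : ℝ) : ℂ) • (γ i * γ j)

/-- The Clifford action of a 3-form. -/
def cliff₃ (e : Fin 5 → NForm 1) (T : NForm 3) (p : N21) : Matrix (Fin 4) (Fin 4) ℂ :=
  (1 / 6 : ℂ) • ∑ i, ∑ j, ∑ k,
    ((T p ![frame e i p, frame e j p, frame e k p] : ℝ) : ℂ) • (γ i * γ j * γ k)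

/-- The spinorial covariant derivative of the metric connection with connection 1-forms `θ`:
`∇_X ε = X(ε) + ¼ ∑ g(∇_X E_i, E_j) E_i · E_j · ε`. -/
def spinDeriv (θ : Fin 5 → Fin 5 → NForm 1) (ε : Spinor) (p : N21) (X : TN p) : Fin 4 → ℂ :=
  mvfderiv 𝓘(ℝ, H21) ε p X +
    (1 / 4 : ℂ) • ∑ i, ∑ j, ((θ j i p ![X] : ℝ) : ℂ) • (γ i * γ j).mulVec (ε p)

/-- The supersymmetry equations for the spinor `ε`, the connection `∇^+` (with connection forms
`θp`), the flux `H`, the dilaton `φ` and the gauge curvature `Ω`: gravitino `∇^+ ε = 0`, dilatino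
`(dφ - ½ H) · ε = 0`, gaugino `Ω · ε = 0`. -/
structure IsSupersymmetric (e : Fin 5 → NForm 1) (θp : Fin 5 → Fin 5 → NForm 1) (H : NForm 3)
    (φ : N21 → ℝ) (Ω : Fin 5 → Fin 5 → NForm 2) (ε : Spinor) : Prop where
  smooth : ContMDiff 𝓘(ℝ, H21) 𝓘(ℝ, Fin 4 → ℂ) ∞ ε
  ne_zero : ∀ p, ε p ≠ 0
  gravitino : ∀ p (X : TN p), spinDeriv θp ε p X = 0
  dilatino : ∀ p, (cliff₁ e (oneForm (mvfderiv 𝓘(ℝ, H21) φ)) p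
    - (1 / 2 : ℂ) • cliff₃ e H p).mulVec (ε p) = 0
  gaugino : ∀ i j p, (cliff₂ e (Ω i j) p).mulVec (ε p) = 0

/-- The spinor `ε` defines the Reeb field `ξ = E_5` and the endomorphism `ψ`: `ξ · ε = √-1 ε` and
`-2 ψ X · ε + ξ · X · ε = √-1 X · ε`. -/
structure DefinesStructure (e : Fin 5 → NForm 1) (ε : Spinor) : Prop where
  reeb : ∀ p, (γ 4).mulVec (ε p) = Complex.I • ε p
  endo : ∀ p (X : TN p), (-2 : ℂ) • (cliffVec e p (ψ e p X)).mulVec (ε p)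
    + (γ 4 * cliffVec e p X).mulVec (ε p) = Complex.I • (cliffVec e p X).mulVec (ε p)

end HeisNil

end

open HeisNil

/-! Everything in the statement is left-invariant, so the theorem is linear algebra in the Lie
algebra of `H21`. Pull-back along `proj` is injective on forms and commutes with `NForm.wedge` and
`NForm.d` (`pull_wedge`, `pull_d`). An invariant form is determined by its value at one point
(`NForm.ext_of_isLeftInvariant`), and there its differential is given by the Chevalley–Eilenberg
formula (`IsLeftInvariant.extDeriv_one`). The only nonzero structure constants are those of `dη`,
whose matrix `B = dηMatrix a b c` is anti-self-dual on the horizontal space. Write `r = a² + b² +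
c²` and `s = λ² + μ² + τ²`.

Anomaly. Brackets are vertical and `dη` is horizontal, so `dT = dη ∧ dη = -2r vol`. Koszul's formula
gives the Levi-Civita forms `-½ B_ij e^5` for horizontal `i, j` and `½ ∑ B_ki e^k` for the pair `(i,
5)` (`IsNilCoframe.connForm_eq_lcForm`). The curvatures of the pairs `(i, 5)` are multiples of `e^5
∧ e^i` and have square zero. The squares of the others sum to `-(3/2) r² vol`
(`IsNilCoframe.pontrjagin_lcForm`). For `A` the quadratic part of the curvature vanishes, so `Ω^i_j
= σ_ij dη`, with squares summing to `-4 s r vol` (`IsNilCoframe.pontrjagin_instanton`). Comparing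
coefficients gives `α' = 16 / (3r - 8s)`, which is positive exactly under the stated inequality.

Supersymmetry. Adding `½ T` cancels the forms of the pairs `(i, 5)` and doubles the rest, so `∇⁺`
has connection forms `-B_ij e^5` (`IsNilCoframe.plusForm_lcForm`). Hence the gravitino, dilatino and
gaugino equations for a constant spinor all follow from `dη · ε = 0`, the last two together with
`E_5 · ε = √-1 ε` or proportionality to `dη`. The first basis spinor has this property, as
anti-self-dual forms annihilate it (`sum_dηMatrix_smul`). -/

noncomputable section

namespace HeisNil

/-! ## Left translations -/

/-- The differential of the left translation by `g` (at any point). -/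
def leftD (g : H21) : H21 →L[ℝ] H21 :=
  ContinuousLinearMap.id ℝ H21 +
    (g 0 • (EuclideanSpace.proj 2 : H21 →L[ℝ] ℝ) + g 1 • (EuclideanSpace.proj 3 : H21 →L[ℝ] ℝ)).smulRight
      (EuclideanSpace.single (4 : Fin 5) (1 : ℝ))

theorem leftD_apply (g v : H21) :
    leftD g v = !₂[v 0, v 1, v 2, v 3, v 4 + (g 0 * v 2 + g 1 * v 3)] := by
  ext i; fin_cases i <;> simp [leftD]

/-- Left translations are affine in these coordinates, which is why `leftD g` needs no base point.
-/
theorem mul_eq_leftD_add (g x : H21) : g * x = leftD g x + g := by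
  ext i; fin_cases i <;> simp [leftD_apply, mul_def] <;> ring

theorem hasFDerivAt_mul_left (g h : H21) : HasFDerivAt (fun x : H21 => g * x) (leftD g) h := by
  have : (fun x : H21 => g * x) = fun x => leftD g x + g := funext fun x => mul_eq_leftD_add g x
  rw [this]
  exact (leftD g).hasFDerivAt.add_const g

theorem fderiv_mul_left (g h : H21) : fderiv ℝ (fun x : H21 => g * x) h = leftD g :=
  (hasFDerivAt_mul_left g h).fderiv

theorem leftD_mul (g h : H21) : leftD (g * h) = (leftD g).comp (leftD h) := by
  ext v i; fin_cases i <;> simp [leftD_apply, mul_def] <;> ring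

theorem leftD_one : leftD 1 = ContinuousLinearMap.id ℝ H21 := by
  ext v i; fin_cases i <;> simp [leftD_apply, one_def]

theorem leftD_inv_comp (g : H21) : (leftD g⁻¹).comp (leftD g) = ContinuousLinearMap.id ℝ H21 := by
  rw [← leftD_mul, inv_mul_cancel, leftD_one]

theorem leftD_comp_inv (g : H21) : (leftD g).comp (leftD g⁻¹) = ContinuousLinearMap.id ℝ H21 := by
  rw [← leftD_mul, mul_inv_cancel, leftD_one]

theorem leftD_injective (g : H21) : Function.Injective (leftD g) :=
  Function.LeftInverse.injective (g := leftD g⁻¹)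
    fun u => DFunLike.congr_fun (leftD_inv_comp g) u

theorem differentiable_leftD : Differentiable ℝ leftD := by
  unfold leftD
  have h (j : Fin 5) : Differentiable ℝ fun x : H21 => x j :=
    (EuclideanSpace.proj j : H21 →L[ℝ] ℝ).differentiable
  have h0 := h 0
  have h1 := h 1
  refine (differentiable_const _).add ?_
  let S : (H21 →L[ℝ] ℝ) →L[ℝ] (H21 →L[ℝ] H21) :=
    (ContinuousLinearMap.smulRightL ℝ H21 H21).flip (EuclideanSpace.single (4 : Fin 5) (1 : ℝ))
  exact S.differentiable.comp ((h0.smul_const _).add (h1.smul_const _))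

/-! ## The projection `H(2,1) → N(2,1)` -/

/-- The quotient charts are local sections of `proj`, so all inverse charts are one and the same
function. Hence reading a form in a chart, as `NForm.d` does, is the same as pulling it back to
`H21`. -/
theorem extChartAt_symm_eq (p : N21) : ⇑(extChartAt 𝓘(ℝ, H21) p).symm = proj := by
  funext y
  simp [exists_of_mem_atlas (chart_mem_atlas H21 p) y]

theorem proj_mul (γ : latticeΓ) (h : H21) : proj ((γ : H21) * h) = proj h :=
  (proj_eq_iff _ _).2 ⟨γ, rfl⟩

theorem proj_surjective : Function.Surjective proj := Quotient.mk_surjective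

theorem proj_extChartAt (p : N21) : proj (extChartAt 𝓘(ℝ, H21) p p) = p := by
  rw [← extChartAt_symm_eq p]
  exact (extChartAt 𝓘(ℝ, H21) p).left_inv (mem_extChartAt_source p)

theorem continuous_proj : Continuous proj := continuous_quotient_mk'

/-- The inverse chart gives smoothness at one point of each fibre; the lattice translations, under
which `proj` is invariant, carry it to the rest of the fibre. -/
theorem contMDiff_proj : ContMDiff 𝓘(ℝ, H21) 𝓘(ℝ, H21) ∞ proj := by
  intro h
  set p := proj h with hp
  obtain ⟨γ, hγ⟩ := (proj_eq_iff _ _).1 (proj_extChartAt p)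
  have h1 : ContMDiffAt 𝓘(ℝ, H21) 𝓘(ℝ, H21) ∞ proj ((γ : H21) * h) := by
    rw [hγ, ← extChartAt_symm_eq p]
    have := contMDiffWithinAt_extChartAt_symm_range_self (I := 𝓘(ℝ, H21)) (n := ∞) p
    simpa [← contMDiffWithinAt_univ] using this
  have h2 : proj = proj ∘ fun x : H21 => (γ : H21) * x := by
    funext x; exact (proj_mul γ x).symm
  rw [h2]
  exact h1.comp h (contDiff_mul_left (γ : H21)).contMDiff.contMDiffAt

/-- Near `h`, the chart at `proj h` composed with `proj` is a left translation. -/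
theorem extChartAt_comp_proj (h : H21) : ∃ γ : latticeΓ,
    (γ : H21) * h = extChartAt 𝓘(ℝ, H21) (proj h) (proj h) ∧
    ∀ᶠ x in 𝓝 h, extChartAt 𝓘(ℝ, H21) (proj h) (proj x) = (γ : H21) * x := by
  set p := proj h with hp
  obtain ⟨γ, hγ⟩ := (proj_eq_iff _ _).1 (proj_extChartAt p)
  refine ⟨γ, hγ, ?_⟩
  have hc : ContinuousAt (fun x : H21 => (γ : H21) * x) h :=
    (contDiff_mul_left (γ : H21)).continuous.continuousAt
  have ht : ∀ᶠ y in 𝓝 ((γ : H21) * h), y ∈ (extChartAt 𝓘(ℝ, H21) p).target := by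
    rw [hγ]; exact extChartAt_target_mem_nhds p
  filter_upwards [hc.eventually ht] with x hx
  rw [← proj_mul γ x, ← extChartAt_symm_eq p]
  exact (extChartAt 𝓘(ℝ, H21) p).right_inv hx

theorem mdifferentiableAt_proj (h : H21) : MDifferentiableAt 𝓘(ℝ, H21) 𝓘(ℝ, H21) proj h :=
  contMDiff_proj.mdifferentiableAt (by simp)

theorem mdifferentiableAt_chart (p : N21) :
    MDifferentiableAt 𝓘(ℝ, H21) 𝓘(ℝ, H21) (extChartAt 𝓘(ℝ, H21) p) p :=
  mdifferentiableAt_extChartAt (mem_chart_source H21 p)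

theorem mfderiv_chart_comp_proj (h : H21) (γ : latticeΓ)
    (hγ : ∀ᶠ x in 𝓝 h, extChartAt 𝓘(ℝ, H21) (proj h) (proj x) = (γ : H21) * x) (v : H21) :
    mfderiv 𝓘(ℝ, H21) 𝓘(ℝ, H21) (extChartAt 𝓘(ℝ, H21) (proj h)) (proj h)
      (mfderiv 𝓘(ℝ, H21) 𝓘(ℝ, H21) proj h v) = leftD γ v := by
  have h1 := mfderiv_comp_apply h (mdifferentiableAt_chart (proj h)) (mdifferentiableAt_proj h) v
  rw [← h1]
  have h2 : (extChartAt 𝓘(ℝ, H21) (proj h) ∘ proj) =ᶠ[𝓝 h] fun x => (γ : H21) * x := hγ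
  rw [h2.mfderiv_eq, mfderiv_eq_fderiv, fderiv_mul_left]
  rfl

theorem bijective_mfderiv_proj (h : H21) :
    Function.Bijective (mfderiv 𝓘(ℝ, H21) 𝓘(ℝ, H21) proj h) := by
  obtain ⟨γ, -, hγ⟩ := extChartAt_comp_proj h
  have hinj : Function.Injective (mfderiv 𝓘(ℝ, H21) 𝓘(ℝ, H21) proj h) := by
    intro v w hvw
    have h1 := mfderiv_chart_comp_proj h γ hγ v
    rw [hvw, mfderiv_chart_comp_proj h γ hγ w] at h1
    exact leftD_injective (γ : H21) h1.symm
  refine ⟨hinj, ?_⟩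
  exact (LinearMap.injective_iff_surjective (f := (show H21 →ₗ[ℝ] H21 from
    (mfderiv 𝓘(ℝ, H21) 𝓘(ℝ, H21) proj h).toLinearMap))).1 hinj

theorem exists_projD (h : H21) : ∃ f : H21 ≃L[ℝ] TN (proj h),
    (f : H21 →L[ℝ] TN (proj h)) = mfderiv 𝓘(ℝ, H21) 𝓘(ℝ, H21) proj h := by
  obtain ⟨γ, -, hγ⟩ := extChartAt_comp_proj h
  let f : H21 →L[ℝ] TN (proj h) := mfderiv 𝓘(ℝ, H21) 𝓘(ℝ, H21) proj h
  let g₁ : TN (proj h) →L[ℝ] H21 :=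
    mfderiv 𝓘(ℝ, H21) 𝓘(ℝ, H21) (extChartAt 𝓘(ℝ, H21) (proj h)) (proj h)
  let g : TN (proj h) →L[ℝ] H21 := (leftD (γ : H21)⁻¹).comp g₁
  have hl : Function.LeftInverse g f := by
    intro v
    change leftD (γ : H21)⁻¹ (g₁ (f v)) = v
    have : g₁ (f v) = leftD γ v := mfderiv_chart_comp_proj h γ hγ v
    rw [this]
    exact DFunLike.congr_fun (leftD_inv_comp (γ : H21)) v
  have hr : Function.RightInverse g f := by
    intro w
    obtain ⟨v, rfl⟩ := (bijective_mfderiv_proj h).2 w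
    exact congrArg f (hl v)
  exact ⟨ContinuousLinearEquiv.equivOfInverse f g hl hr, rfl⟩

/-- The differential of the projection, an isomorphism. -/
def projD (h : H21) : H21 ≃L[ℝ] TN (proj h) := (exists_projD h).choose

theorem coe_projD (h : H21) :
    (projD h : H21 →L[ℝ] TN (proj h)) = mfderiv 𝓘(ℝ, H21) 𝓘(ℝ, H21) proj h :=
  (exists_projD h).choose_spec

end HeisNil
end

noncomputable section

namespace HeisNil

theorem two_le_smoothness : minSmoothness ℝ 2 ≤ ∞ := by
  rw [minSmoothness_of_isRCLikeNormedField]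
  exact WithTop.coe_le_coe.2 le_top

/-! ## Pull-back of forms -/

section Pull

variable {k : ℕ}

theorem pull_apply (α : NForm k) (h : H21) (v : Fin k → H21) :
    α.pull h v = α (proj h) fun i => projD h (v i) := by
  simp only [NForm.pull, ← coe_projD]
  rfl

theorem pull_symm_apply (α : NForm k) (h : H21) (v : Fin k → TN (proj h)) :
    α (proj h) v = α.pull h fun i => (projD h).symm (v i) := by
  rw [pull_apply]
  simp

theorem pull_add (α β : NForm k) : (α + β).pull = α.pull + β.pull := rfl

theorem pull_injective : Function.Injective (NForm.pull : NForm k → _) := by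
  intro α β hαβ
  funext p
  obtain ⟨h, rfl⟩ := proj_surjective p
  ext v
  rw [pull_symm_apply, pull_symm_apply, hαβ]

theorem pull_mul_left (α : NForm k) (γ : latticeΓ) (h : H21) :
    (α.pull ((γ : H21) * h)).compContinuousLinearMap (leftD γ) = α.pull h := by
  have h1 : proj ∘ (fun x : H21 => (γ : H21) * x) = proj := funext fun x => proj_mul γ x
  -- The type of `mfderiv … f h` depends on `f h`, so rewriting `f` is blocked; generalising over
  -- `f` lets the equation be eliminated by `rfl`.
  have h2 : ∀ f : H21 → N21, f = proj → ∀ w : Fin k → H21,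
      α (f h) (fun i => mfderiv 𝓘(ℝ, H21) 𝓘(ℝ, H21) f h (w i)) = α.pull h w := by
    rintro f rfl w; rfl
  ext w
  rw [← h2 _ h1 w]
  have h3 (v : H21) : mfderiv 𝓘(ℝ, H21) 𝓘(ℝ, H21) (proj ∘ fun x : H21 => (γ : H21) * x) h v =
      mfderiv 𝓘(ℝ, H21) 𝓘(ℝ, H21) proj ((γ : H21) * h) (leftD γ v) := by
    have hd : MDifferentiableAt 𝓘(ℝ, H21) 𝓘(ℝ, H21) (fun x : H21 => (γ : H21) * x) h :=
      (hasFDerivAt_mul_left (γ : H21) h).differentiableAt.mdifferentiableAt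
    have h4 := mfderiv_comp_apply h (mdifferentiableAt_proj ((γ : H21) * h)) hd v
    refine h4.trans ?_
    rw [mfderiv_eq_fderiv, fderiv_mul_left]
    rfl
  simp only [h3]
  rfl

/-- The chart at `proj h` computes `α.d` as the exterior derivative of `α.pull` at a translate `γ *
h`. Invariance of `α.pull` under `γ` and naturality of `extDeriv` bring this back to `h`. -/
theorem pull_d (α : NForm k) (hα : Differentiable ℝ α.pull) (h : H21) :
    α.d.pull h = extDeriv α.pull h := by
  obtain ⟨γ, hγ, hev⟩ := extChartAt_comp_proj h
  have key : ∀ f : H21 → N21, f = proj → ∀ y : H21,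
      ((α (f y)).compContinuousLinearMap (mfderiv 𝓘(ℝ, H21) 𝓘(ℝ, H21) f y) :
          H21 [⋀^Fin k]→L[ℝ] ℝ) = α.pull y := by
    rintro f rfl y; rfl
  have h1 : α.d (proj h) = (extDeriv α.pull ((γ : H21) * h)).compContinuousLinearMap
      (mfderiv 𝓘(ℝ, H21) 𝓘(ℝ, H21) (extChartAt 𝓘(ℝ, H21) (proj h)) (proj h)) := by
    unfold NForm.d
    rw [← hγ]
    congr 2
    funext y
    exact key _ (extChartAt_symm_eq (proj h)) y
  have h2 : α.pull = fun x => (α.pull ((γ : H21) * x)).compContinuousLinearMap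
      (fderiv ℝ (fun x : H21 => (γ : H21) * x) x) := by
    funext x
    rw [fderiv_mul_left, pull_mul_left]
  conv_rhs => rw [h2]
  rw [extDeriv_pullback (r := ∞) (hα _) (contDiff_mul_left (γ : H21)).contDiffAt
    two_le_smoothness]
  ext v
  change α.d (proj h) (fun i => mfderiv 𝓘(ℝ, H21) 𝓘(ℝ, H21) proj h (v i)) = _
  rw [h1]
  change extDeriv α.pull ((γ : H21) * h) (fun i =>
    mfderiv 𝓘(ℝ, H21) 𝓘(ℝ, H21) (extChartAt 𝓘(ℝ, H21) (proj h)) (proj h)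
      (mfderiv 𝓘(ℝ, H21) 𝓘(ℝ, H21) proj h (v i))) = _
  rw [fderiv_mul_left]
  exact congrArg _ (funext fun i => mfderiv_chart_comp_proj h γ hev (v i))

end Pull

/-! ## Left-invariant forms on `H(2,1)` -/

section LeftInvariant

variable {k : ℕ} {θ θ' : H21 → H21 [⋀^Fin k]→L[ℝ] ℝ}

theorem isLeftInvariant_iff :
    IsLeftInvariant θ ↔ ∀ g h, (θ (g * h)).compContinuousLinearMap (leftD g) = θ h := by
  simp only [IsLeftInvariant, fderiv_mul_left]

theorem IsLeftInvariant.apply_leftD (hθ : IsLeftInvariant θ) (h : H21) (v : Fin k → H21) :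
    θ h (fun i => leftD h (v i)) = θ 1 v := by
  have := DFunLike.congr_fun (isLeftInvariant_iff.1 hθ h 1) v
  rw [mul_one] at this
  exact this

theorem IsLeftInvariant.eq_comp (hθ : IsLeftInvariant θ) (h : H21) :
    θ h = (θ 1).compContinuousLinearMap (leftD h⁻¹) := by
  have := isLeftInvariant_iff.1 hθ h⁻¹ h
  rw [inv_mul_cancel] at this
  exact this.symm

theorem IsLeftInvariant.ext (hθ : IsLeftInvariant θ) (hθ' : IsLeftInvariant θ')
    (h1 : θ 1 = θ' 1) : θ = θ' := by
  funext h
  rw [hθ.eq_comp, hθ'.eq_comp, h1]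

theorem IsLeftInvariant.differentiable (hθ : IsLeftInvariant θ) : Differentiable ℝ θ := by
  have h1 : θ = fun h => (θ 1).compContinuousLinearMap (leftD h⁻¹) := funext hθ.eq_comp
  rw [h1]
  intro h
  refine (differentiableAt_const _).continuousAlternatingMapCompContinuousLinearMap ?_
  exact (differentiable_leftD.comp (contDiff_inv.differentiable (by simp))) h

theorem IsLeftInvariant.add (hθ : IsLeftInvariant θ) (hθ' : IsLeftInvariant θ') :
    IsLeftInvariant (θ + θ') := fun g h => by
  rw [Pi.add_apply, Pi.add_apply, ← hθ g h, ← hθ' g h]; rfl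

theorem IsLeftInvariant.smul (c : ℝ) (hθ : IsLeftInvariant θ) : IsLeftInvariant (c • θ) :=
  fun g h => by rw [Pi.smul_apply, Pi.smul_apply, ← hθ g h]; rfl

theorem IsLeftInvariant.neg (hθ : IsLeftInvariant θ) : IsLeftInvariant (-θ) :=
  fun g h => by rw [Pi.neg_apply, Pi.neg_apply, ← hθ g h]; rfl

theorem IsLeftInvariant.sub (hθ : IsLeftInvariant θ) (hθ' : IsLeftInvariant θ') :
    IsLeftInvariant (θ - θ') := by
  rw [sub_eq_add_neg]; exact hθ.add hθ'.neg

theorem IsLeftInvariant.zero : IsLeftInvariant (0 : H21 → H21 [⋀^Fin k]→L[ℝ] ℝ) :=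
  fun _ _ => rfl

theorem IsLeftInvariant.extDeriv (hθ : IsLeftInvariant θ) : IsLeftInvariant (extDeriv θ) := by
  intro g h
  rw [← extDeriv_pullback (r := ∞) (hθ.differentiable _) (contDiff_mul_left g).contDiffAt
    two_le_smoothness]
  congr 1
  funext x
  exact hθ g x

/-! ### The Lie algebra of `H(2,1)` and the Chevalley–Eilenberg formula -/

/-- The bracket of the Lie algebra of `H(2,1)`. -/
def bracket (v w : H21) : H21 :=
  EuclideanSpace.single 4 (v 0 * w 2 + v 1 * w 3 - w 0 * v 2 - w 1 * v 3)

theorem leftD_bracket (h v w : H21) : leftD h (bracket v w) = bracket v w := by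
  ext i; fin_cases i <;> simp [leftD_apply, bracket]

theorem differentiable_leftD_apply (v : H21) : Differentiable ℝ fun h => leftD h v :=
  differentiable_leftD.clm_apply (differentiable_const v)

theorem fderiv_leftD_apply (v x u : H21) :
    fderiv ℝ (fun h => leftD h v) x u = EuclideanSpace.single 4 (u 0 * v 2 + u 1 * v 3) := by
  let f : H21 →L[ℝ] H21 := (v 2 • (EuclideanSpace.proj 0 : H21 →L[ℝ] ℝ)
    + v 3 • (EuclideanSpace.proj 1 : H21 →L[ℝ] ℝ)).smulRight
      (EuclideanSpace.single (4 : Fin 5) (1 : ℝ))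
  have hf : (fun h => leftD h v) = fun h => v + f h := by
    funext h
    ext i; fin_cases i <;> simp [leftD_apply, f] <;> ring
  have : HasFDerivAt (fun h => leftD h v) f x := by
    rw [hf]
    exact f.hasFDerivAt.const_add v
  rw [this.fderiv]
  ext i; fin_cases i <;> simp [f] <;> ring

theorem lieBracket_leftD (v w x : H21) :
    VectorField.lieBracket ℝ (fun h => leftD h v) (fun h => leftD h w) x = bracket v w := by
  rw [VectorField.lieBracket, fderiv_leftD_apply, fderiv_leftD_apply]
  ext i; fin_cases i <;> simp [leftD_apply, bracket] <;> ring

/-- In the invariant formula for the exterior derivative, evaluated on the left-invariant fields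
`leftD h (v i)`, the functions to be differentiated are constant; only the bracket terms remain. -/
theorem IsLeftInvariant.extDeriv_one {θ : H21 → H21 [⋀^Fin (k + 1)]→L[ℝ] ℝ}
    (hθ : IsLeftInvariant θ) (v : Fin (k + 2) → H21) :
    _root_.extDeriv θ 1 v = -∑ i : Fin (k + 1), ∑ j ≥ i, (-1) ^ (i + j : ℕ) •
      θ 1 (Matrix.vecCons (bracket (v i.castSucc) (v j.succ))
        (j.removeNth <| i.castSucc.removeNth v)) := by
  have h1 := extDeriv_apply_vectorField (V := fun i h => leftD h (v i)) (hθ.differentiable 1)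
    (fun i => differentiable_leftD_apply (v i) 1)
  have h2 : ∀ i : Fin (k + 2), (fun x => θ x (i.removeNth fun j => leftD x (v j))) =
      fun _ => θ 1 (i.removeNth v) := by
    intro i; funext x
    exact hθ.apply_leftD x (i.removeNth v)
  simp only [h2, fderiv_fun_const, Pi.zero_apply, lieBracket_leftD, leftD_one,
    ContinuousLinearMap.id_apply] at h1
  simpa using h1

theorem IsLeftInvariant.extDeriv_one₁ {θ : H21 → H21 [⋀^Fin 1]→L[ℝ] ℝ}
    (hθ : IsLeftInvariant θ) (u v : H21) :
    _root_.extDeriv θ 1 ![u, v] = -θ 1 ![bracket u v] := by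
  rw [hθ.extDeriv_one]
  simp

theorem IsLeftInvariant.extDeriv_one₂ {θ : H21 → H21 [⋀^Fin 2]→L[ℝ] ℝ}
    (hθ : IsLeftInvariant θ) (u v w : H21) :
    _root_.extDeriv θ 1 ![u, v, w] =
      -θ 1 ![bracket u v, w] + θ 1 ![bracket u w, v] - θ 1 ![bracket v w, u] := by
  rw [hθ.extDeriv_one]
  simp only [← Finset.filter_le_eq_Ici, Finset.sum_filter, Nat.reduceAdd, Fin.sum_univ_two]
  simp
  have e1 : Fin.removeNth 1 (Fin.removeNth 1 ![u, v, w]) = ![u] := by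
    funext i; fin_cases i; rfl
  have e2 : Fin.removeNth 1 ![v, w] = ![v] := by funext i; fin_cases i; rfl
  rw [e1, e2]
  ring

theorem IsLeftInvariant.extDeriv_one₃ {θ : H21 → H21 [⋀^Fin 3]→L[ℝ] ℝ}
    (hθ : IsLeftInvariant θ) (u v w x : H21) :
    _root_.extDeriv θ 1 ![u, v, w, x] =
      -θ 1 ![bracket u v, w, x] + θ 1 ![bracket u w, v, x] - θ 1 ![bracket u x, v, w]
      - θ 1 ![bracket v w, u, x] + θ 1 ![bracket v x, u, w] - θ 1 ![bracket w x, u, v] := by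
  rw [hθ.extDeriv_one]
  simp only [← Finset.filter_le_eq_Ici, Finset.sum_filter, Nat.reduceAdd, Fin.sum_univ_three]
  simp
  have e1 : Fin.removeNth 2 (Fin.removeNth 2 ![u, v, w, x]) = ![u, v] := by
    funext i; fin_cases i <;> rfl
  have e2 : Fin.removeNth 2 (Fin.removeNth 1 ![u, v, w, x]) = ![u, w] := by
    funext i; fin_cases i <;> rfl
  have e3 : Fin.removeNth 1 (Fin.removeNth 1 ![u, v, w, x]) = ![u, x] := by
    funext i; fin_cases i <;> rfl
  have e4 : Fin.removeNth 2 ![v, w, x] = ![v, w] := by funext i; fin_cases i <;> rfl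
  have e5 : Fin.removeNth 1 ![v, w, x] = ![v, x] := by funext i; fin_cases i <;> rfl
  rw [e1, e2, e3, e4, e5]
  ring

end LeftInvariant

end HeisNil
end

noncomputable section

namespace HeisNil

/-! ## Evaluation of wedge products -/

theorem vec₁ {X : Type} (v : Fin 1 → X) : v = ![v 0] := by funext i; fin_cases i; rfl

theorem vec₂ {X : Type} (v : Fin 2 → X) : v = ![v 0, v 1] := by funext i; fin_cases i <;> rfl

section WedgeEval

variable {V : Type} [AddCommGroup V] [Module ℝ V] [TopologicalSpace V] {k l : ℕ}

theorem wedge_apply (α : V [⋀^Fin k]→L[ℝ] ℝ) (β : V [⋀^Fin l]→L[ℝ] ℝ) (v : Fin (k + l) → V) :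
    wedge α β v = ((k.factorial : ℝ) * (l.factorial : ℝ))⁻¹ *
      ∑ s : Equiv.Perm (Fin (k + l)), (Equiv.Perm.sign s : ℝ) *
        (α (fun i => v (s (Fin.castAdd l i))) * β (fun j => v (s (Fin.natAdd k j)))) := by
  simp only [wedge, ContinuousAlternatingMap.smul_apply, smul_eq_mul,
    ContinuousMultilinearMap.alternatization_apply_apply]
  congr 1
  refine Finset.sum_congr rfl fun s _ => ?_
  rcases Int.units_eq_one_or (Equiv.Perm.sign s) with h | h <;> simp [h] <;> rfl

theorem wedge_compContinuousLinearMap {W : Type} [AddCommGroup W] [Module ℝ W] [TopologicalSpace W]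
    (α : V [⋀^Fin k]→L[ℝ] ℝ) (β : V [⋀^Fin l]→L[ℝ] ℝ) (f : W →L[ℝ] V) :
    (wedge α β).compContinuousLinearMap f =
      wedge (α.compContinuousLinearMap f) (β.compContinuousLinearMap f) := by
  ext v
  simp only [ContinuousAlternatingMap.compContinuousLinearMap_apply, wedge_apply]
  rfl

theorem swap_eval₂ (β : V [⋀^Fin 2]→L[ℝ] ℝ) (u v : V) : β ![v, u] = -β ![u, v] := by
  have := β.map_swap ![u, v] (i := 0) (j := 1) (by decide)
  rw [show ![u, v] ∘ ⇑(Equiv.swap (0 : Fin 2) 1) = ![v, u] by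
    funext i; fin_cases i <;> rfl] at this
  exact this

/-- Permutations are sorted by the image `p` of `0`; the transposition of `0` and `p` contributes
the sign. This expands the wedge products by recursion on the number of slots. -/
theorem sum_sign_mul_succ {n : ℕ} (f : (Fin (n + 1) → Fin (n + 1)) → ℝ) :
    ∑ s : Equiv.Perm (Fin (n + 1)), (Equiv.Perm.sign s : ℝ) * f s =
      ∑ p : Fin (n + 1), (if p = 0 then 1 else -1) * ∑ s : Equiv.Perm (Fin n),
        (Equiv.Perm.sign s : ℝ) *
          f (Fin.cons p fun j => Equiv.swap 0 p (s j).succ) := by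
  rw [← Equiv.sum_comp Equiv.Perm.decomposeFin.symm, Fintype.sum_prod_type]
  refine Finset.sum_congr rfl fun p _ => ?_
  rw [Finset.mul_sum]
  refine Finset.sum_congr rfl fun s _ => ?_
  have : ⇑(Equiv.Perm.decomposeFin.symm (p, s)) =
      Fin.cons p fun j => Equiv.swap 0 p (s j).succ := by
    funext i
    refine Fin.cases ?_ (fun j => ?_) i <;> simp
  rw [this, Equiv.Perm.decomposeFin.symm_sign]
  split_ifs <;> simp

theorem sum_sign_mul_two (f : Fin 2 → Fin 2 → ℝ) :
    ∑ s : Equiv.Perm (Fin 2), (Equiv.Perm.sign s : ℝ) * f (s 0) (s 1) = f 0 1 - f 1 0 := by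
  refine (sum_sign_mul_succ (n := 1) fun g => f (g 0) (g 1)).trans ?_
  simp only [Nat.reduceAdd, Fin.sum_univ_two, Fintype.sum_unique]
  simp [sub_eq_add_neg]

theorem sum_sign_mul_three (f : Fin 3 → Fin 3 → Fin 3 → ℝ) :
    ∑ s : Equiv.Perm (Fin 3), (Equiv.Perm.sign s : ℝ) * f (s 0) (s 1) (s 2) =
      f 0 1 2 - f 0 2 1 - f 1 0 2 + f 1 2 0 + f 2 0 1 - f 2 1 0 := by
  refine (sum_sign_mul_succ (n := 2) fun g => f (g 0) (g 1) (g 2)).trans ?_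
  have e (p : Fin 3) := sum_sign_mul_two fun i j =>
    f p (Equiv.swap 0 p i.succ) (Equiv.swap 0 p j.succ)
  calc _ = ∑ p : Fin 3, (if p = 0 then (1 : ℝ) else -1) *
        (f p (Equiv.swap 0 p 1) (Equiv.swap 0 p 2) - f p (Equiv.swap 0 p 2) (Equiv.swap 0 p 1)) :=
        Finset.sum_congr rfl fun p _ => congrArg _ (e p)
    _ = (1 : ℝ) * (f 0 1 2 - f 0 2 1) + (-1) * (f 1 0 2 - f 1 2 0)
        + (-1) * (f 2 1 0 - f 2 0 1) := by
        rw [Fin.sum_univ_three]; rfl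
    _ = _ := by ring

theorem sum_sign_mul_four (f : Fin 4 → Fin 4 → Fin 4 → Fin 4 → ℝ) :
    ∑ s : Equiv.Perm (Fin 4), (Equiv.Perm.sign s : ℝ) * f (s 0) (s 1) (s 2) (s 3) =
      (f 0 1 2 3 - f 0 1 3 2 - f 0 2 1 3 + f 0 2 3 1 + f 0 3 1 2 - f 0 3 2 1)
      - (f 1 0 2 3 - f 1 0 3 2 - f 1 2 0 3 + f 1 2 3 0 + f 1 3 0 2 - f 1 3 2 0)
      - (f 2 1 0 3 - f 2 1 3 0 - f 2 0 1 3 + f 2 0 3 1 + f 2 3 1 0 - f 2 3 0 1)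
      - (f 3 1 2 0 - f 3 1 0 2 - f 3 2 1 0 + f 3 2 0 1 + f 3 0 1 2 - f 3 0 2 1) := by
  refine (sum_sign_mul_succ (n := 3) fun g => f (g 0) (g 1) (g 2) (g 3)).trans ?_
  have e (p : Fin 4) := sum_sign_mul_three fun i j k =>
    f p (Equiv.swap 0 p i.succ) (Equiv.swap 0 p j.succ) (Equiv.swap 0 p k.succ)
  calc _ = ∑ p : Fin 4, (if p = 0 then (1 : ℝ) else -1) * _ :=
        Finset.sum_congr rfl fun p _ => congrArg _ (e p)
    _ = (1 : ℝ) *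
          (f 0 1 2 3 - f 0 1 3 2 - f 0 2 1 3 + f 0 2 3 1 + f 0 3 1 2 - f 0 3 2 1)
        + (-1) * (f 1 0 2 3 - f 1 0 3 2 - f 1 2 0 3 + f 1 2 3 0 + f 1 3 0 2 - f 1 3 2 0)
        + (-1) * (f 2 1 0 3 - f 2 1 3 0 - f 2 0 1 3 + f 2 0 3 1 + f 2 3 1 0 - f 2 3 0 1)
        + (-1) * (f 3 1 2 0 - f 3 1 0 2 - f 3 2 1 0 + f 3 2 0 1 + f 3 0 1 2 - f 3 0 2 1) := by
        rw [Fin.sum_univ_four]; rfl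
    _ = _ := by ring

theorem wedge_apply₁₁ (α β : V [⋀^Fin 1]→L[ℝ] ℝ) (u v : V) :
    wedge α β ![u, v] = α ![u] * β ![v] - α ![v] * β ![u] := by
  rw [wedge_apply]
  have := sum_sign_mul_two fun i j => α ![![u, v] i] * β ![![u, v] j]
  simp only [vec₁ fun i => ![u, v] (_ : Fin 2)]
  refine (congrArg _ this).trans ?_
  simp

theorem wedge_apply₁₂ (α : V [⋀^Fin 1]→L[ℝ] ℝ) (β : V [⋀^Fin 2]→L[ℝ] ℝ) (u v w : V) :
    wedge α β ![u, v, w] = α ![u] * β ![v, w] - α ![v] * β ![u, w] + α ![w] * β ![u, v] := by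
  rw [wedge_apply]
  have := sum_sign_mul_three fun i j k => α ![![u, v, w] i] * β ![![u, v, w] j, ![u, v, w] k]
  refine (congrArg _ ((Finset.sum_congr rfl fun s _ => ?_).trans this)).trans ?_
  · rw [vec₁ fun i => ![u, v, w] _, vec₂ fun i => ![u, v, w] _]; rfl
  · simp [swap_eval₂ β v w, swap_eval₂ β u w, swap_eval₂ β u v]
    ring

theorem wedge_apply₂₂ (α β : V [⋀^Fin 2]→L[ℝ] ℝ) (u v w x : V) :
    wedge α β ![u, v, w, x] = α ![u, v] * β ![w, x] - α ![u, w] * β ![v, x]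
      + α ![u, x] * β ![v, w] + α ![v, w] * β ![u, x] - α ![v, x] * β ![u, w]
      + α ![w, x] * β ![u, v] := by
  rw [wedge_apply]
  have := sum_sign_mul_four fun i j k l => α ![![u, v, w, x] i, ![u, v, w, x] j] *
    β ![![u, v, w, x] k, ![u, v, w, x] l]
  refine (congrArg _ ((Finset.sum_congr rfl fun s _ => ?_).trans this)).trans ?_
  · rw [vec₂ fun i => ![u, v, w, x] _, vec₂ fun i => ![u, v, w, x] _]; rfl
  · simp [swap_eval₂ β u v, swap_eval₂ β u w, swap_eval₂ β u x, swap_eval₂ β v w,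
      swap_eval₂ β v x, swap_eval₂ β w x, swap_eval₂ α u v, swap_eval₂ α u w, swap_eval₂ α u x,
      swap_eval₂ α v w, swap_eval₂ α v x, swap_eval₂ α w x]
    ring

end WedgeEval

end HeisNil
end

noncomputable section

namespace HeisNil

section WedgeEval

variable {V : Type} [AddCommGroup V] [Module ℝ V] [TopologicalSpace V]

theorem vec₄ {X : Type} (v : Fin 4 → X) : v = ![v 0, v 1, v 2, v 3] := by
  funext i; fin_cases i <;> rfl

/-- Only the permutations that give `v 4` to `β` survive. There are `4!` of them, all with the same
contribution because `α` is alternating, and this cancels the normalisation. -/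
theorem wedge_apply₄₁ (α : V [⋀^Fin 4]→L[ℝ] ℝ) (β : V [⋀^Fin 1]→L[ℝ] ℝ) (v : Fin 5 → V)
    (hβ : ∀ j, j ≠ 4 → β ![v j] = 0) :
    wedge α β v = -(α ![v 1, v 2, v 3, v 0] * β ![v 4]) := by
  -- The rotation, an even permutation, moves the slot of `β` from the last place to the first,
  -- where `sum_sign_mul_succ` splits the sum.
  rw [wedge_apply, ← Equiv.sum_comp (Equiv.mulRight (finRotate 5))]
  have h1 := sum_sign_mul_succ (n := 4) fun g =>
    α ![v (g 1), v (g 2), v (g 3), v (g 4)] * β ![v (g 0)]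
  have h2 : ∑ s : Equiv.Perm (Fin 5), (Equiv.Perm.sign s : ℝ) *
      (α ![v (s 1), v (s 2), v (s 3), v (s 4)] * β ![v (s 0)]) =
        -(24 * (α ![v 1, v 2, v 3, v 0] * β ![v 4])) := by
    refine h1.trans ?_
    rw [Finset.sum_eq_single (4 : Fin 5)]
    · have h3 : ∀ s : Equiv.Perm (Fin 4), (Equiv.Perm.sign s : ℝ) *
          (α ![v (Equiv.swap 0 4 (s 0).succ), v (Equiv.swap 0 4 (s 1).succ),
            v (Equiv.swap 0 4 (s 2).succ), v (Equiv.swap 0 4 (s 3).succ)] * β ![v 4]) =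
          α ![v 1, v 2, v 3, v 0] * β ![v 4] := by
        intro s
        have h4 := α.toAlternatingMap.map_perm ![v 1, v 2, v 3, v 0] s
        have h5 : ![v 1, v 2, v 3, v 0] ∘ ⇑s =
          ![v (Equiv.swap 0 4 (s 0).succ), v (Equiv.swap 0 4 (s 1).succ),
            v (Equiv.swap 0 4 (s 2).succ), v (Equiv.swap 0 4 (s 3).succ)] := by
          have h6 : ∀ i : Fin 4, ![v 1, v 2, v 3, v 0] i = v (Equiv.swap 0 4 i.succ) := by
            intro i; fin_cases i <;> rfl
          funext i
          fin_cases i <;> exact h6 _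
        rw [h5] at h4
        have h7 : α ![v (Equiv.swap 0 4 (s 0).succ), v (Equiv.swap 0 4 (s 1).succ),
            v (Equiv.swap 0 4 (s 2).succ), v (Equiv.swap 0 4 (s 3).succ)] =
              Equiv.Perm.sign s • α ![v 1, v 2, v 3, v 0] := h4
        rw [h7]
        rcases Int.units_eq_one_or (Equiv.Perm.sign s) with h | h <;> simp [h]
      refine (congrArg _ (Finset.sum_congr rfl fun s _ => h3 s)).trans ?_
      simp [Fintype.card_perm, Nat.factorial]
    · intro p _ hp
      have : β ![v p] = 0 := hβ p hp
      simp [this]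
    · simp
  have h3 : Equiv.Perm.sign (finRotate 5) = 1 := by decide
  refine (congrArg _ ((Finset.sum_congr rfl fun s _ => ?_).trans h2)).trans ?_
  · rw [vec₄ fun i => v _, vec₁ fun i => v _]
    simp only [Equiv.coe_mulRight, Equiv.Perm.sign_mul, h3, mul_one]
    rfl
  · simp [Nat.factorial]

theorem apply_add₁ (α : V [⋀^Fin 1]→L[ℝ] ℝ) (u v : V) : α ![u + v] = α ![u] + α ![v] :=
  α.toMultilinearMap.cons_add ![] u v

theorem apply_smul₁ (α : V [⋀^Fin 1]→L[ℝ] ℝ) (c : ℝ) (u : V) : α ![c • u] = c * α ![u] :=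
  α.toMultilinearMap.cons_smul ![] c u

/-- The linear functional of a 1-form. -/
def lin₁ (α : V [⋀^Fin 1]→L[ℝ] ℝ) : V →ₗ[ℝ] ℝ where
  toFun v := α ![v]
  map_add' := apply_add₁ α
  map_smul' c v := by simpa using apply_smul₁ α c v

theorem lin₁_apply (α : V [⋀^Fin 1]→L[ℝ] ℝ) (v : V) : lin₁ α v = α ![v] := rfl

end WedgeEval

/-! ## Coframes -/

section Coframe

variable {e : Fin 5 → NForm 1}

theorem NForm.wedge_eval {k l : ℕ} (α : NForm k) (β : NForm l) (p : N21) :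
    α.wedge β p = HeisNil.wedge (α p) (β p) := rfl

theorem e₂_apply (e : Fin 5 → NForm 1) (i j : Fin 5) (p : N21) (u v : TN p) :
    e₂ e i j p ![u, v] = e i p ![u] * e j p ![v] - e i p ![v] * e j p ![u] :=
  wedge_apply₁₁ _ _ _ _

theorem IsCoframe.apply_frame (he : IsCoframe e) (i j : Fin 5) (p : N21) :
    e i p ![frame e j p] = if i = j then 1 else 0 := by
  have h := Function.invFun_eq ((he p).2 (Pi.single j 1))
  have h2 := congrFun h i
  refine h2.trans ?_
  simp [Pi.single_apply]

theorem IsCoframe.ext (he : IsCoframe e) {p : N21} {u v : TN p}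
    (h : ∀ i, e i p ![u] = e i p ![v]) : u = v :=
  (he p).1 (funext h)

theorem IsCoframe.sum_frame (he : IsCoframe e) (p : N21) (f : Fin 5 → ℝ) (i : Fin 5) :
    e i p ![∑ k, f k • frame e k p] = f i := by
  rw [← lin₁_apply, map_sum]
  simp only [map_smul, lin₁_apply, he.apply_frame, smul_eq_mul]
  simp

theorem IsCoframe.eq_sum (he : IsCoframe e) (p : N21) (v : TN p) :
    v = ∑ k, e k p ![v] • frame e k p :=
  he.ext fun i => (he.sum_frame p (fun k => e k p ![v]) i).symm

/-! ### Pointwise identities for the `SU(2)`-structure -/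

theorem F_zero_apply (p : N21) (u v : TN p) : F e 0 p ![u, v] =
    e 0 p ![u] * e 1 p ![v] - e 0 p ![v] * e 1 p ![u]
      + (e 2 p ![u] * e 3 p ![v] - e 2 p ![v] * e 3 p ![u]) := by
  rw [← e₂_apply, ← e₂_apply]; rfl

theorem F_one_apply (p : N21) (u v : TN p) : F e 1 p ![u, v] =
    e 0 p ![u] * e 2 p ![v] - e 0 p ![v] * e 2 p ![u]
      + (e 3 p ![u] * e 1 p ![v] - e 3 p ![v] * e 1 p ![u]) := by
  rw [← e₂_apply, ← e₂_apply]; rfl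

theorem F_two_apply (p : N21) (u v : TN p) : F e 2 p ![u, v] =
    e 0 p ![u] * e 3 p ![v] - e 0 p ![v] * e 3 p ![u]
      + (e 1 p ![u] * e 2 p ![v] - e 1 p ![v] * e 2 p ![u]) := by
  rw [← e₂_apply, ← e₂_apply]; rfl

theorem ext₂ {α β : NForm 2} (h : ∀ p (u v : TN p), α p ![u, v] = β p ![u, v]) : α = β := by
  funext p
  ext v
  rw [vec₂ v]
  exact h p _ _

theorem ext₄ {α β : NForm 4}
    (h : ∀ p (u v w x : TN p), α p ![u, v, w, x] = β p ![u, v, w, x]) : α = β := by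
  funext p
  ext v
  rw [vec₄ v]
  exact h p _ _ _ _

theorem F_wedge_F (i j : Fin 3) :
    (F e i).wedge (F e j) = if i = j then (F e 0).wedge (F e 0) else 0 := by
  apply ext₄
  intro p u v w x
  fin_cases i <;> fin_cases j
  all_goals
    simp only [Fin.reduceFinMk, Fin.zero_eta, Fin.mk_one, Fin.isValue, reduceIte, Fin.reduceEq,
      NForm.wedge_eval, wedge_apply₂₂, F_zero_apply, F_one_apply, F_two_apply, zero_ne_one,
      one_ne_zero, Pi.zero_apply, ContinuousAlternatingMap.coe_zero]
  all_goals ring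

theorem NForm.wedge_apply_eq_zero (α : NForm 4) (β : NForm 1) (p : N21)
    (h : (α.wedge β) p = 0) (v : Fin 5 → TN p) : HeisNil.wedge (α p) (β p) v = 0 := by
  rw [NForm.wedge_eval] at h
  rw [h]
  rfl

theorem IsCoframe.isSU2Structure (he : IsCoframe e) : IsSU2Structure (η e) (F e) where
  volume := by
    obtain ⟨v, hv⟩ : ∃ v : NForm 4, v = (F e 0).wedge (F e 0) := ⟨_, rfl⟩
    refine ⟨v, fun i j => hv ▸ F_wedge_F i j, fun p hp => ?_⟩
    have h := wedge_apply₄₁ (v p) (e 4 p) (fun i => frame e i p) (by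
      intro j hj
      rw [he.apply_frame, if_neg hj.symm])
    have h := (NForm.wedge_apply_eq_zero v (e 4) p hp fun i => frame e i p).symm.trans h
    rw [hv] at h
    simp only [NForm.wedge_eval, wedge_apply₂₂, F_zero_apply, he.apply_frame, Fin.reduceEq,
      reduceIte] at h
    norm_num at h
  positive := by
    intro p X Y h
    have h0 := h (frame e 0 p)
    have h1 := h (frame e 1 p)
    have h2 := h (frame e 2 p)
    have h3 := h (frame e 3 p)
    simp only [F_zero_apply, F_one_apply, he.apply_frame, Fin.reduceEq, reduceIte] at h0 h1 h2 h3
    norm_num at h0 h1 h2 h3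
    -- Testing on the horizontal frame determines the horizontal part of `Y` from that of `X`;
    -- substituting it turns `F_3(X, Y)` into the sum of the squares of the horizontal components of
    -- `X`.
    rw [F_two_apply, ← h0, ← h1, ← h2, show e 1 p ![Y] = -e 2 p ![X] by linarith]
    nlinarith [sq_nonneg (e 0 p ![X]), sq_nonneg (e 1 p ![X]), sq_nonneg (e 2 p ![X]),
      sq_nonneg (e 3 p ![X])]

theorem dη_apply {a b c : ℝ} (h : (e 4).d = a • (e₂ e 0 1 - e₂ e 2 3) + b • (e₂ e 0 2 + e₂ e 1 3)
    + c • (e₂ e 0 3 - e₂ e 1 2)) (p : N21) (u v : TN p) :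
    (e 4).d p ![u, v] =
      a * (e 0 p ![u] * e 1 p ![v] - e 0 p ![v] * e 1 p ![u]
        - (e 2 p ![u] * e 3 p ![v] - e 2 p ![v] * e 3 p ![u]))
      + b * (e 0 p ![u] * e 2 p ![v] - e 0 p ![v] * e 2 p ![u]
        + (e 1 p ![u] * e 3 p ![v] - e 1 p ![v] * e 3 p ![u]))
      + c * (e 0 p ![u] * e 3 p ![v] - e 0 p ![v] * e 3 p ![u]
        - (e 1 p ![u] * e 2 p ![v] - e 1 p ![v] * e 2 p ![u])) := by
  rw [h]
  simp only [← e₂_apply]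
  rfl

theorem IsNilCoframe.hodgeH_dη {a b c : ℝ} (he : IsNilCoframe a b c e) :
    hodgeH e (η e).d = -(η e).d := by
  apply ext₂
  intro p u v
  have hd := dη_apply he.d_vertical p
  have h : (hodgeH e (η e).d) p ![u, v] =
      (e 4).d p ![frame e 0 p, frame e 1 p] * e₂ e 2 3 p ![u, v]
      - (e 4).d p ![frame e 0 p, frame e 2 p] * e₂ e 1 3 p ![u, v]
      + (e 4).d p ![frame e 0 p, frame e 3 p] * e₂ e 1 2 p ![u, v]
      + (e 4).d p ![frame e 1 p, frame e 2 p] * e₂ e 0 3 p ![u, v]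
      - (e 4).d p ![frame e 1 p, frame e 3 p] * e₂ e 0 2 p ![u, v]
      + (e 4).d p ![frame e 2 p, frame e 3 p] * e₂ e 0 1 p ![u, v] := rfl
  have h' : (-(η e).d) p ![u, v] = -((e 4).d p ![u, v]) := rfl
  rw [h, h']
  simp only [hd, e₂_apply, he.isCoframe.apply_frame, Fin.reduceEq, reduceIte]
  norm_num
  ring

theorem IsCoframe.apply_ψ (he : IsCoframe e) (p : N21) (X : TN p) (i : Fin 5) :
    e i p ![ψ e p X] = F e 0 p ![frame e i p, X] :=
  he.sum_frame p _ i

theorem IsCoframe.ψ_coord (he : IsCoframe e) (p : N21) (X : TN p) :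
    (e 0 p ![ψ e p X] = e 1 p ![X]) ∧ (e 1 p ![ψ e p X] = -e 0 p ![X]) ∧
    (e 2 p ![ψ e p X] = e 3 p ![X]) ∧ (e 3 p ![ψ e p X] = -e 2 p ![X]) ∧
    e 4 p ![ψ e p X] = 0 := by
  refine ⟨?_, ?_, ?_, ?_, ?_⟩ <;>
  · rw [he.apply_ψ, F_zero_apply]
    simp only [he.apply_frame, Fin.reduceEq, reduceIte]
    norm_num

/-- On `ℍ` the anti-self-dual form `dη` is `ψ`-invariant and trace-free against `F_1`; the matrix
`s` is irrelevant to both conditions. -/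
theorem IsNilCoframe.isSU2Instanton {a b c : ℝ} (he : IsNilCoframe a b c e)
    (s : Fin 5 → Fin 5 → ℝ) : IsSU2Instanton e fun i j => s i j • (e 4).d := by
  intro i j p
  have hd := dη_apply he.d_vertical p
  have h (u v : TN p) : (s i j • (e 4).d) p ![u, v] = s i j * (e 4).d p ![u, v] := rfl
  constructor
  · intro k l
    rw [h, h, hd, hd]
    obtain ⟨h0, h1, h2, h3, -⟩ := he.isCoframe.ψ_coord p (frame e k p)
    obtain ⟨h0', h1', h2', h3', -⟩ := he.isCoframe.ψ_coord p (frame e l p)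
    rw [h0, h1, h2, h3, h0', h1', h2', h3']
    ring
  · simp only [h, hd]
    rw [← Finset.mul_sum]
    have hψ (k : Fin 5) := he.isCoframe.ψ_coord p (frame e k p)
    simp only [(hψ _).1, (hψ _).2.1, (hψ _).2.2.1, (hψ _).2.2.2.1, he.isCoframe.apply_frame,
      Fin.sum_univ_five, Fin.reduceEq, reduceIte]
    norm_num

theorem torsion_apply (e : Fin 5 → NForm 1) (p : N21) (u v w : TN p) :
    torsion₃ e p ![u, v, w] = e 4 p ![u] * (e 4).d p ![v, w] - e 4 p ![v] * (e 4).d p ![u, w]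
      + e 4 p ![w] * (e 4).d p ![u, v] :=
  wedge_apply₁₂ _ _ _ _ _

/-- The values of `T` on `(E_5, E_1, E_j)` for `j = 2, 3, 4` are `a, b, c`. -/
theorem IsNilCoframe.torsion_ne_zero {a b c : ℝ} (he : IsNilCoframe a b c e)
    (habc : a ^ 2 + b ^ 2 + c ^ 2 ≠ 0) : torsion₃ e ≠ 0 := by
  intro h
  have hd := dη_apply he.d_vertical (proj 1)
  have key (i j : Fin 5) : torsion₃ e (proj 1)
    ![frame e 4 (proj 1), frame e i (proj 1), frame e j (proj 1)] = 0 := by rw [h]; rfl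
  have h1 := key 0 1
  have h2 := key 0 2
  have h3 := key 0 3
  simp only [torsion_apply, hd, he.isCoframe.apply_frame, Fin.reduceEq, reduceIte] at h1 h2 h3
  norm_num at h1 h2 h3
  apply habc
  rw [h1, h2, h3]
  norm_num

end Coframe

end HeisNil
end

noncomputable section

namespace HeisNil

/-! ## Vector fields on `N(2,1)` and their lifts -/

/-- The lift of a vector field to `H(2,1)`. -/
def VField.lift (Y : VField) (h : H21) : H21 := (projD h).symm (Y (proj h))

theorem VField.lift_eq_mpullback (Y : VField) :
    Y.lift = VectorField.mpullback 𝓘(ℝ, H21) 𝓘(ℝ, H21) proj Y := by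
  funext h
  rw [VectorField.mpullback_apply, ← coe_projD]
  exact (DFunLike.congr_fun (ContinuousLinearMap.inverse_equiv (projD h)) (Y (proj h))).symm

theorem isInvertible_mfderiv_proj (h : H21) :
    (mfderiv 𝓘(ℝ, H21) 𝓘(ℝ, H21) proj h).IsInvertible := ⟨projD h, coe_projD h⟩

theorem VField.DiffAt.differentiableAt_lift {Y : VField} {h : H21} (hY : Y.DiffAt (proj h)) :
    DifferentiableAt ℝ Y.lift h := by
  have h1 := MDifferentiableAt.mpullback_vectorField (n := 2) hY
    ((contMDiff_proj h).of_le (by exact WithTop.coe_le_coe.2 le_top))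
    (isInvertible_mfderiv_proj h) le_rfl
  rw [← Y.lift_eq_mpullback] at h1
  rw [← mdifferentiableAt_iff_differentiableAt]
  exact ((contMDiff_snd_tangentBundle_modelSpace H21 𝓘(ℝ, H21)).contMDiffAt.mdifferentiableAt
    one_ne_zero).comp _ h1

/-- Near `p`, the field `Y` is the pull-back by the chart of its own lift, since the inverse chart
is `proj`. -/
theorem VField.diffAt_of_contDiff_lift {Y : VField} (hY : ContDiff ℝ 1 Y.lift) (p : N21) :
    Y.DiffAt p := by
  have h1 : ContMDiff 𝓘(ℝ, H21) 𝓘(ℝ, H21).tangent 1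
      (fun x => (⟨x, Y.lift x⟩ : TangentBundle 𝓘(ℝ, H21) H21)) :=
    contMDiff_vectorSpace_iff_contDiff.2 hY
  have h2 := (h1 (extChartAt 𝓘(ℝ, H21) p p)).mdifferentiableAt one_ne_zero
  have h3 := MDifferentiableAt.mpullback_vectorField (f := extChartAt 𝓘(ℝ, H21) p) (x₀ := p)
    (n := 2) (V := Y.lift) h2 contMDiffAt_extChartAt
    (isInvertible_mfderiv_extChartAt (mem_extChartAt_source p)) le_rfl
  have h4 := VectorField.eventuallyEq_mpullback_mpullbackWithin_extChartAt (I := 𝓘(ℝ, H21))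
    (s := Set.univ) (x := p) Y
  have key : ∀ f : H21 → N21, f = proj →
      VectorField.mpullbackWithin 𝓘(ℝ, H21) 𝓘(ℝ, H21) f Y Set.univ = Y.lift := by
    rintro f rfl
    rw [VectorField.mpullbackWithin_univ, Y.lift_eq_mpullback]
  rw [modelWithCornersSelf_coe, Set.range_id, key _ (extChartAt_symm_eq p), nhdsWithin_univ] at h4
  refine h3.congr_of_eventuallyEq ?_
  filter_upwards [h4] with q hq
  rw [hq]

instance : IsManifold 𝓘(ℝ, H21) (minSmoothness ℝ 2) N21 :=
  IsManifold.of_le (n := ∞) two_le_smoothness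

theorem mlieBracket_eq_lieBracket (V W : ∀ x : H21, TangentSpace 𝓘(ℝ, H21) x) (h : H21) :
    VectorField.mlieBracket 𝓘(ℝ, H21) V W h = VectorField.lieBracket ℝ V W h := by
  rw [← VectorField.mlieBracketWithin_univ, VectorField.mlieBracketWithin_eq_lieBracketWithin]
  exact congrFun (VectorField.lieBracketWithin_univ (𝕜 := ℝ) (V := (V : H21 → H21))) h

theorem lift_mlieBracket {Y Z : VField} {h : H21} (hY : Y.DiffAt (proj h))
    (hZ : Z.DiffAt (proj h)) :
    VField.lift (VectorField.mlieBracket 𝓘(ℝ, H21) Y Z) h =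
      VectorField.lieBracket ℝ Y.lift Z.lift h := by
  rw [VField.lift_eq_mpullback, VectorField.mpullback_mlieBracket (n := ∞) hY hZ
    (contMDiff_proj h) two_le_smoothness, mlieBracket_eq_lieBracket, ← VField.lift_eq_mpullback,
    ← VField.lift_eq_mpullback]

theorem mdifferentiableAt_of_comp_proj {G : Type*} [NormedAddCommGroup G] [NormedSpace ℝ G]
    {f : N21 → G} {p : N21} (hf : DifferentiableAt ℝ (f ∘ proj) (extChartAt 𝓘(ℝ, H21) p p)) :
    MDifferentiableAt 𝓘(ℝ, H21) 𝓘(ℝ, G) f p := by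
  have h1 := hf.mdifferentiableAt.comp p (mdifferentiableAt_chart p)
  refine h1.congr_of_eventuallyEq ?_
  filter_upwards [extChartAt_source_mem_nhds (I := 𝓘(ℝ, H21)) p] with q hq
  have := (extChartAt 𝓘(ℝ, H21) p).left_inv hq
  rw [extChartAt_symm_eq] at this
  simp only [Function.comp_apply, this]

/-! ## Invariant coframes -/

section Coframe

variable {e : Fin 5 → NForm 1}

theorem pull_one_lift (α : NForm 1) (Y : VField) (h : H21) :
    α.pull h ![Y.lift h] = α (proj h) ![Y (proj h)] := by
  rw [pull_apply]
  congr 1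
  funext i
  fin_cases i
  simp [VField.lift]

/-- The value at the identity of the lift of the frame dual to `e`. -/
def frameAtOne (e : Fin 5 → NForm 1) (i : Fin 5) : H21 := VField.lift (frame e i) 1

theorem IsCoframe.pull_ext (he : IsCoframe e) {h u v : H21}
    (huv : ∀ i, (e i).pull h ![u] = (e i).pull h ![v]) : u = v := by
  apply (projD h).injective
  apply he.ext
  intro i
  have := huv i
  rw [pull_apply, pull_apply] at this
  convert this using 2 <;> (funext j; fin_cases j; rfl)

/-- The frame dual to an invariant coframe is invariant: both sides have the same constant
components. This gives the frame its smoothness and makes its brackets computable. -/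
theorem IsCoframe.lift_frame (he : IsCoframe e) (hl : ∀ i, IsLeftInvariant (e i).pull) (i : Fin 5)
    (h : H21) : VField.lift (frame e i) h = leftD h (frameAtOne e i) := by
  apply he.pull_ext (h := h)
  intro j
  have h1 := (hl j).apply_leftD h ![frameAtOne e i]
  have h2 : (fun k : Fin 1 => leftD h (![frameAtOne e i] k)) = ![leftD h (frameAtOne e i)] := by
    funext k; fin_cases k; rfl
  rw [← h2, h1, pull_one_lift, frameAtOne, pull_one_lift, he.apply_frame, he.apply_frame]

theorem IsCoframe.diffAt_frame (he : IsCoframe e) (hl : ∀ i, IsLeftInvariant (e i).pull)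
    (i : Fin 5) (p : N21) : VField.DiffAt (frame e i) p := by
  apply VField.diffAt_of_contDiff_lift
  rw [funext (he.lift_frame hl i), contDiff_euclidean]
  intro j
  have h (j : Fin 5) : ContDiff ℝ 1 fun x : H21 => x j := (contDiff_euclidean.1 contDiff_id) j
  have h0 := h 0
  have h1 := h 1
  fin_cases j <;> simp [leftD_apply] <;> fun_prop

/-- Cartan's formula, where the derivative terms are absent because `e^k(E_i)` is constant. Both
sides are lifted to `H21` and compared through `bracket`. -/
theorem apply_frame_mlieBracket (he : IsCoframe e) (hl : ∀ i, IsLeftInvariant (e i).pull)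
    (k i j : Fin 5) (p : N21) :
    e k p ![VectorField.mlieBracket 𝓘(ℝ, H21) (frame e i) (frame e j) p] =
      -(e k).d p ![frame e i p, frame e j p] := by
  obtain ⟨h, rfl⟩ := proj_surjective p
  have h1 := lift_mlieBracket (he.diffAt_frame hl i (proj h)) (he.diffAt_frame hl j (proj h))
  rw [funext (he.lift_frame hl i), funext (he.lift_frame hl j), lieBracket_leftD] at h1
  rw [← pull_one_lift, h1, pull_symm_apply (e k).d, pull_d _ (hl k).differentiable]
  have h2 : (fun l => (projD h).symm (![frame e i (proj h), frame e j (proj h)] l)) =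
      fun l => leftD h (![frameAtOne e i, frameAtOne e j] l) := by
    funext l
    fin_cases l
    · exact he.lift_frame hl i h
    · exact he.lift_frame hl j h
  rw [h2, (hl k).extDeriv.apply_leftD, (hl k).extDeriv_one₁, neg_neg]
  have h3 := (hl k).apply_leftD h ![bracket (frameAtOne e i) (frameAtOne e j)]
  rw [← h3]
  congr 1
  funext l
  fin_cases l
  exact (leftD_bracket _ _ _).symm

theorem VField.DiffAt.mdifferentiableAt_apply {α : NForm 1} (hα : IsLeftInvariant α.pull)
    {Y : VField} {p : N21} (hY : Y.DiffAt p) :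
    MDifferentiableAt 𝓘(ℝ, H21) 𝓘(ℝ, ℝ) (fun q => α q ![Y q]) p := by
  apply mdifferentiableAt_of_comp_proj
  rw [← proj_extChartAt p] at hY
  have h1 := hY.differentiableAt_lift
  -- Invariance moves the whole dependence on the point into `leftD h⁻¹` and the lift, leaving a
  -- fixed functional.
  have h2 : (fun q => α q ![Y q]) ∘ proj =
      fun h => lin₁ (α.pull 1) (leftD h⁻¹ (Y.lift h)) := by
    funext h
    rw [Function.comp_apply, ← pull_one_lift, hα.eq_comp, lin₁_apply]
    change α.pull 1 _ = _
    congr 1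
    funext i
    fin_cases i
    rfl
  rw [h2]
  have h3 : DifferentiableAt ℝ (fun h => leftD h⁻¹ (Y.lift h)) (extChartAt 𝓘(ℝ, H21) p p) :=
    (differentiable_leftD.comp (contDiff_inv.differentiable (by simp)) _).clm_apply h1
  exact (lin₁ (α.pull 1)).toContinuousLinearMap.differentiableAt.comp _ h3

/-! ## Connections from connection forms -/

/-- The continuous linear functional of a 1-form. -/
def clm₁ {V : Type} [AddCommGroup V] [Module ℝ V] [TopologicalSpace V]
    (α : V [⋀^Fin 1]→L[ℝ] ℝ) : V →L[ℝ] ℝ where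
  toLinearMap := lin₁ α
  cont := α.cont.comp (continuous_pi fun i => by fin_cases i; exact continuous_id)

theorem clm₁_apply {V : Type} [AddCommGroup V] [Module ℝ V] [TopologicalSpace V]
    (α : V [⋀^Fin 1]→L[ℝ] ℝ) (v : V) : clm₁ α v = α ![v] := rfl

/-- The operator `Y ↦ ∇ Y` with connection forms `C` in the frame dual to `e`. -/
def connFun (e : Fin 5 → NForm 1) (C : Fin 5 → Fin 5 → NForm 1) (Y : VField) (p : N21) :
    TN p →L[ℝ] TN p :=
  ∑ i, (mvfderiv 𝓘(ℝ, H21) (fun q => e i q ![Y q]) p +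
    ∑ j, e j p ![Y p] • clm₁ (C i j p)).smulRight (frame e i p)

theorem IsCoframe.apply_connFun (he : IsCoframe e) (C : Fin 5 → Fin 5 → NForm 1) (Y : VField)
    (p : N21) (X : TN p) (i : Fin 5) : e i p ![connFun e C Y p X] =
      mvfderiv 𝓘(ℝ, H21) (fun q => e i q ![Y q]) p X + ∑ j, e j p ![Y p] * C i j p ![X] := by
  have h : connFun e C Y p X = ∑ i, (mvfderiv 𝓘(ℝ, H21) (fun q => e i q ![Y q]) p X +
      ∑ j, e j p ![Y p] * C i j p ![X]) • frame e i p := by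
    simp [connFun, clm₁_apply]
  rw [h]
  exact he.sum_frame p _ i

/-- The derivative terms supply the Leibniz rule. The forms `C` enter only algebraically, so no
regularity of `C` is needed. -/
theorem isCovariantDerivativeOn_connFun (he : IsCoframe e) (hl : ∀ i, IsLeftInvariant (e i).pull)
    (C : Fin 5 → Fin 5 → NForm 1) : IsCovariantDerivativeOn H21 (I := 𝓘(ℝ, H21))
      (V := fun p : N21 => TangentSpace 𝓘(ℝ, H21) p) (connFun e C) Set.univ where
  add {Y Z p} hY hZ _ := by
    ext X
    apply he.ext
    intro i
    rw [add_apply, apply_add₁, he.apply_connFun, he.apply_connFun,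
      he.apply_connFun]
    have h1 : (fun q => e i q ![(Y + Z) q]) =
        (fun q => e i q ![Y q]) + fun q => e i q ![Z q] := by
      funext q
      exact apply_add₁ _ _ _
    rw [h1, mvfderiv_add (VField.DiffAt.mdifferentiableAt_apply (hl i) hY)
      (VField.DiffAt.mdifferentiableAt_apply (hl i) hZ), add_apply]
    have h2 (j : Fin 5) : e j p ![(Y + Z) p] = e j p ![Y p] + e j p ![Z p] := apply_add₁ _ _ _
    simp only [h2, add_mul, Finset.sum_add_distrib]
    ring
  leibniz {Y g p} hY hg _ := by
    ext X
    apply he.ext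
    intro i
    rw [add_apply, apply_add₁, he.apply_connFun]
    have h1 : (fun q => e i q ![(g • Y) q]) = g * fun q => e i q ![Y q] := by
      funext q
      exact apply_smul₁ _ _ _
    have h2 (j : Fin 5) : e j p ![(g • Y) p] = g p * e j p ![Y p] := apply_smul₁ _ _ _
    have h3 : e i p ![(g p • connFun e C Y p) X] = g p * e i p ![connFun e C Y p X] :=
      apply_smul₁ _ _ _
    have h4 : e i p ![((mvfderiv 𝓘(ℝ, H21) g p).smulRight (Y p)) X] =
        mvfderiv 𝓘(ℝ, H21) g p X * e i p ![Y p] := apply_smul₁ _ _ _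
    rw [h1, mvfderiv_mul hg (VField.DiffAt.mdifferentiableAt_apply (hl i) hY), h3, h4,
      he.apply_connFun]
    simp only [h2, mul_assoc, ← Finset.mul_sum, add_apply,
      smul_apply, smul_eq_mul]
    ring

/-- The connection with connection forms `C` in the frame dual to `e`. -/
def connOf (he : IsCoframe e) (hl : ∀ i, IsLeftInvariant (e i).pull)
    (C : Fin 5 → Fin 5 → NForm 1) : NConnection :=
  ⟨connFun e C, isCovariantDerivativeOn_connFun he hl C⟩

theorem ext₁ {α β : NForm 1} (h : ∀ p (u : TN p), α p ![u] = β p ![u]) : α = β := by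
  funext p
  ext v
  rw [vec₁ v]
  exact h p _

theorem connForm_apply (nabla : NConnection) (i j : Fin 5) (p : N21) (X : TN p) :
    connForm e nabla i j p ![X] = e i p ![nabla (frame e j) p X] := by
  have h : (fun k => nabla (frame e j) p (![X] k)) = ![nabla (frame e j) p X] := by
    funext k; fin_cases k; rfl
  rw [← h]
  rfl

theorem connForm_connOf (he : IsCoframe e) (hl : ∀ i, IsLeftInvariant (e i).pull)
    (C : Fin 5 → Fin 5 → NForm 1) (i j : Fin 5) : connForm e (connOf he hl C) i j = C i j := by
  apply ext₁
  intro p X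
  rw [connForm_apply]
  refine (he.apply_connFun C _ p X i).trans ?_
  simp only [he.apply_frame, mvfderiv_const]
  simp

end Coframe

end HeisNil
end

noncomputable section

namespace HeisNil

/-! ## Invariant forms on `N(2,1)` -/

section Invariant

variable {k l : ℕ}

theorem pull_wedge (α : NForm k) (β : NForm l) (h : H21) :
    (α.wedge β).pull h = HeisNil.wedge (α.pull h) (β.pull h) :=
  wedge_compContinuousLinearMap _ _ _

theorem isLeftInvariant_pull_wedge {α : NForm k} {β : NForm l} (hα : IsLeftInvariant α.pull)
    (hβ : IsLeftInvariant β.pull) : IsLeftInvariant (α.wedge β).pull := by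
  intro g h
  rw [pull_wedge, pull_wedge, wedge_compContinuousLinearMap, hα g h, hβ g h]

theorem isLeftInvariant_pull_d {α : NForm k} (hα : IsLeftInvariant α.pull) :
    IsLeftInvariant α.d.pull := by
  rw [funext (pull_d α hα.differentiable)]
  exact hα.extDeriv

theorem isLeftInvariant_pull_sum {ι : Type*} (s : Finset ι) {α : ι → NForm k}
    (hα : ∀ i ∈ s, IsLeftInvariant (α i).pull) : IsLeftInvariant (∑ i ∈ s, α i).pull := by
  classical
  induction s using Finset.induction_on with
  | empty => exact IsLeftInvariant.zero
  | insert i s hi ih =>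
    rw [Finset.sum_insert hi, pull_add]
    exact (hα i (Finset.mem_insert_self i s)).add
      (ih fun j hj => hα j (Finset.mem_insert_of_mem hj))

theorem NForm.ext_of_isLeftInvariant {α β : NForm k} (hα : IsLeftInvariant α.pull)
    (hβ : IsLeftInvariant β.pull) (h : α (proj 1) = β (proj 1)) : α = β := by
  apply pull_injective
  apply hα.ext hβ
  rw [NForm.pull, NForm.pull, h]

/-- The base point of `N(2,1)`. -/
abbrev basePoint : N21 := proj 1

/-- The Lie algebra bracket on the tangent space at the base point. -/
def tbracket (u v : TN basePoint) : TN basePoint :=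
  projD 1 (bracket ((projD 1).symm u) ((projD 1).symm v))

theorem d_apply₁ {α : NForm 1} (hα : IsLeftInvariant α.pull) (u v : TN basePoint) :
    α.d basePoint ![u, v] = -α basePoint ![tbracket u v] := by
  rw [pull_symm_apply, pull_d _ hα.differentiable, pull_symm_apply]
  rw [vec₂ fun i => (projD 1).symm (![u, v] i), vec₁ fun i => (projD 1).symm (![tbracket u v] i)]
  refine (hα.extDeriv_one₁ _ _).trans ?_
  simp [tbracket]

theorem vec₃ {X : Type} (v : Fin 3 → X) : v = ![v 0, v 1, v 2] := by
  funext i; fin_cases i <;> rfl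

theorem d_apply₂ {α : NForm 2} (hα : IsLeftInvariant α.pull) (u v w : TN basePoint) :
    α.d basePoint ![u, v, w] = -α basePoint ![tbracket u v, w] + α basePoint ![tbracket u w, v]
      - α basePoint ![tbracket v w, u] := by
  have h (x y : TN basePoint) : α basePoint ![x, y] =
      α.pull 1 ![(projD 1).symm x, (projD 1).symm y] := by
    rw [pull_symm_apply, vec₂ fun i => (projD 1).symm (![x, y] i)]
    rfl
  rw [pull_symm_apply, pull_d _ hα.differentiable, h, h, h]
  rw [vec₃ fun i => (projD 1).symm (![u, v, w] i)]
  refine (hα.extDeriv_one₂ _ _ _).trans ?_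
  simp [tbracket]

theorem d_apply₃ {α : NForm 3} (hα : IsLeftInvariant α.pull) (u v w x : TN basePoint) :
    α.d basePoint ![u, v, w, x] =
      -α basePoint ![tbracket u v, w, x] + α basePoint ![tbracket u w, v, x]
      - α basePoint ![tbracket u x, v, w] - α basePoint ![tbracket v w, u, x]
      + α basePoint ![tbracket v x, u, w] - α basePoint ![tbracket w x, u, v] := by
  have h (x y z : TN basePoint) : α basePoint ![x, y, z] =
      α.pull 1 ![(projD 1).symm x, (projD 1).symm y, (projD 1).symm z] := by
    rw [pull_symm_apply, vec₃ fun i => (projD 1).symm (![x, y, z] i)]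
    rfl
  rw [pull_symm_apply, pull_d _ hα.differentiable, h, h, h, h, h, h]
  rw [vec₄ fun i => (projD 1).symm (![u, v, w, x] i)]
  refine (hα.extDeriv_one₃ _ _ _ _).trans ?_
  simp [tbracket]

/-- Invariance reduces linearity of `d` to the base point, where `d_apply₁` is visibly linear in the
form. -/
theorem d_sum_smul {ι : Type*} [Fintype ι] {α : ι → NForm 1}
    (hα : ∀ i, IsLeftInvariant (α i).pull) (c : ι → ℝ) :
    (∑ i, c i • α i).d = ∑ i, c i • (α i).d := by
  have h1 : IsLeftInvariant (∑ i, c i • α i).pull :=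
    isLeftInvariant_pull_sum _ fun i _ => (hα i).smul (c i)
  apply NForm.ext_of_isLeftInvariant (isLeftInvariant_pull_d h1)
  · exact isLeftInvariant_pull_sum _ fun i _ => (isLeftInvariant_pull_d (hα i)).smul (c i)
  · ext v
    rw [vec₂ v]
    refine (d_apply₁ h1 _ _).trans ?_
    simp only [Finset.sum_apply, Pi.smul_apply, ContinuousAlternatingMap.sum_apply,
      ContinuousAlternatingMap.smul_apply, d_apply₁ (hα _)]
    simp

theorem d_smul {α : NForm 1} (hα : IsLeftInvariant α.pull) (c : ℝ) : (c • α).d = c • α.d := by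
  have := d_sum_smul (ι := Unit) (fun _ => hα) fun _ => c
  simpa using this

end Invariant

section NilCoframe

variable {a b c : ℝ} {e : Fin 5 → NForm 1}

theorem isLeftInvariant_e₂ (hl : ∀ i, IsLeftInvariant (e i).pull) (i j : Fin 5) :
    IsLeftInvariant (e₂ e i j).pull :=
  isLeftInvariant_pull_wedge (hl i) (hl j)

theorem isLeftInvariant_F (hl : ∀ i, IsLeftInvariant (e i).pull) (i : Fin 3) :
    IsLeftInvariant (F e i).pull := by
  have h := isLeftInvariant_e₂ hl
  fin_cases i
  · exact (h 0 1).add (h 2 3)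
  · exact (h 0 2).add (h 3 1)
  · exact (h 0 3).add (h 1 2)

/-- Closedness of the horizontal `e^i` says that all brackets are vertical. This is what kills most
terms in `IsNilCoframe.d_F` and `IsNilCoframe.d_torsion`. -/
theorem IsNilCoframe.apply_tbracket (he : IsNilCoframe a b c e) {i : Fin 5} (hi : i ≠ 4)
    (u v : TN basePoint) : e i basePoint ![tbracket u v] = 0 := by
  have := d_apply₁ (he.leftInvariant i) u v
  rw [he.d_horizontal i hi] at this
  have h0 : (0 : NForm 2) basePoint ![u, v] = 0 := rfl
  rw [h0] at this
  linarith

theorem IsNilCoframe.d_F (he : IsNilCoframe a b c e) (i : Fin 3) : (F e i).d = 0 := by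
  have hF := isLeftInvariant_F he.leftInvariant i
  apply NForm.ext_of_isLeftInvariant (isLeftInvariant_pull_d hF) IsLeftInvariant.zero
  have h0 (u v : TN basePoint) := he.apply_tbracket (i := 0) (by decide) u v
  have h1 (u v : TN basePoint) := he.apply_tbracket (i := 1) (by decide) u v
  have h2 (u v : TN basePoint) := he.apply_tbracket (i := 2) (by decide) u v
  have h3 (u v : TN basePoint) := he.apply_tbracket (i := 3) (by decide) u v
  ext v
  rw [vec₃ v]
  refine (d_apply₂ hF _ _ _).trans ?_
  change _ = (0 : ℝ)
  fin_cases i <;>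
    simp only [Fin.reduceFinMk, Fin.zero_eta, Fin.mk_one, F_zero_apply, F_one_apply, F_two_apply,
      h0, h1, h2, h3] <;> ring

/-- In the Chevalley–Eilenberg formula the argument `[u, v]` can only be absorbed by `η`, as `dη`
vanishes on vertical vectors, and `η([u, v]) = -dη(u, v)`. -/
theorem IsNilCoframe.d_torsion (he : IsNilCoframe a b c e) :
    (torsion₃ e).d = (e 4).d.wedge (e 4).d := by
  have hd := isLeftInvariant_pull_d (he.leftInvariant 4)
  have hT : IsLeftInvariant (torsion₃ e).pull := isLeftInvariant_pull_wedge (he.leftInvariant 4) hd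
  have hW : IsLeftInvariant ((e 4).d.wedge (e 4).d).pull := isLeftInvariant_pull_wedge hd hd
  refine NForm.ext_of_isLeftInvariant (k := 4) (isLeftInvariant_pull_d hT) hW ?_
  have h0 (u v : TN basePoint) := he.apply_tbracket (i := 0) (by decide) u v
  have h1 (u v : TN basePoint) := he.apply_tbracket (i := 1) (by decide) u v
  have h2 (u v : TN basePoint) := he.apply_tbracket (i := 2) (by decide) u v
  have h3 (u v : TN basePoint) := he.apply_tbracket (i := 3) (by decide) u v
  have h4 (u v : TN basePoint) : e 4 basePoint ![tbracket u v] = -(e 4).d basePoint ![u, v] := by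
    rw [d_apply₁ (he.leftInvariant 4), neg_neg]
  have h5 (u v w : TN basePoint) : (e 4).d basePoint ![tbracket u v, w] = 0 := by
    rw [dη_apply he.d_vertical]
    simp only [h0, h1, h2, h3]
    ring
  ext v
  rw [vec₄ v]
  refine (d_apply₃ hT _ _ _ _).trans ?_
  refine Eq.trans ?_ (wedge_apply₂₂ _ _ _ _ _ _).symm
  simp only [torsion_apply, h4, h5]
  ring

end NilCoframe

end HeisNil
end

noncomputable section

namespace HeisNil

/-! ## The Levi-Civita connection -/

/-- The components of `de^5` in the frame dual to `e`. -/
def dηMatrix (a b c : ℝ) : Matrix (Fin 5) (Fin 5) ℝ :=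
  !![0, a, b, c, 0;
     -a, 0, -c, b, 0;
     -b, c, 0, -a, 0;
     -c, -b, a, 0, 0;
     0, 0, 0, 0, 0]

/-- The components `-e^k([E_i, E_j])` of `de^k`. -/
def structureCoeff (a b c : ℝ) (k i j : Fin 5) : ℝ :=
  if k = 4 then dηMatrix a b c i j else 0

/-- The Christoffel symbols `e^k(∇_{E_i} E_j)` of the Levi-Civita connection. -/
def lcCoeff (a b c : ℝ) (k j i : Fin 5) : ℝ :=
  -(1 / 2) * (structureCoeff a b c k i j - structureCoeff a b c i j k + structureCoeff a b c j k i)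

/-- The connection forms of the Levi-Civita connection. -/
def lcForm (a b c : ℝ) (e : Fin 5 → NForm 1) (k j : Fin 5) : NForm 1 :=
  ∑ i, lcCoeff a b c k j i • e i

theorem dηMatrix_skew (a b c : ℝ) (i j : Fin 5) :
    dηMatrix a b c i j = -dηMatrix a b c j i := by
  fin_cases i <;> fin_cases j <;> simp [dηMatrix]

theorem structureCoeff_skew (a b c : ℝ) (k i j : Fin 5) :
    structureCoeff a b c k i j = -structureCoeff a b c k j i := by
  unfold structureCoeff
  split_ifs
  · exact dηMatrix_skew a b c i j
  · simp

theorem lcCoeff_skew (a b c : ℝ) (k j i : Fin 5) : lcCoeff a b c k j i = -lcCoeff a b c j k i := by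
  simp only [lcCoeff]
  linarith [structureCoeff_skew a b c k i j, structureCoeff_skew a b c i j k,
    structureCoeff_skew a b c j k i]

theorem lcCoeff_sub (a b c : ℝ) (k i j : Fin 5) :
    lcCoeff a b c k j i - lcCoeff a b c k i j = -structureCoeff a b c k i j := by
  simp only [lcCoeff]
  linarith [structureCoeff_skew a b c k i j, structureCoeff_skew a b c i j k,
    structureCoeff_skew a b c j k i]

variable {a b c : ℝ} {e : Fin 5 → NForm 1}

theorem lcForm_apply (k j : Fin 5) (p : N21) (X : TN p) :
    lcForm a b c e k j p ![X] = ∑ i, lcCoeff a b c k j i * e i p ![X] := by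
  simp only [lcForm, Finset.sum_apply, Pi.smul_apply, ContinuousAlternatingMap.sum_apply,
    ContinuousAlternatingMap.smul_apply, smul_eq_mul]

theorem IsNilCoframe.d_frame (he : IsNilCoframe a b c e) (k i j : Fin 5) (p : N21) :
    (e k).d p ![frame e i p, frame e j p] = structureCoeff a b c k i j := by
  by_cases hk : k = 4
  · subst hk
    rw [dη_apply he.d_vertical]
    simp only [he.isCoframe.apply_frame]
    fin_cases i <;> fin_cases j <;> simp [structureCoeff, dηMatrix]
  · rw [he.d_horizontal k hk, structureCoeff, if_neg hk]
    rfl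

theorem IsCoframe.metric_frame_right (he : IsCoframe e) (p : N21) (u : TN p) (j : Fin 5) :
    metric e p u (frame e j p) = e j p ![u] := by
  simp [metric, he.apply_frame]

theorem IsCoframe.metric_frame_left (he : IsCoframe e) (p : N21) (u : TN p) (j : Fin 5) :
    metric e p (frame e j p) u = e j p ![u] := by
  simp [metric, he.apply_frame]

theorem apply_sum₁ {V : Type} [AddCommGroup V] [Module ℝ V] [TopologicalSpace V]
    (α : V [⋀^Fin 1]→L[ℝ] ℝ) (f : Fin 5 → ℝ) (v : Fin 5 → V) :
    α ![∑ i, f i • v i] = ∑ i, f i * α ![v i] := by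
  rw [← lin₁_apply, map_sum]
  simp [lin₁_apply]

/-- Koszul's argument in a frame with constant inner products: compatibility makes the Christoffel
symbols skew, vanishing torsion prescribes their antisymmetrisation, and together these determine
them. -/
theorem IsNilCoframe.connForm_eq_lcForm (he : IsNilCoframe a b c e) {nabla : NConnection}
    (hn : IsLeviCivita e nabla) : connForm e nabla = lcForm a b c e := by
  have hc := he.isCoframe
  have hdiff := hc.diffAt_frame he.leftInvariant
  funext k j
  apply ext₁
  intro p X
  let G (k j i : Fin 5) : ℝ := connForm e nabla k j p ![frame e i p]
  have hskew (k j i : Fin 5) : G k j i = -G j k i := by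
    have h1 := hn.compatible p (frame e j) (frame e k) (hdiff j p) (hdiff k p) (frame e i p)
    rw [hc.metric_frame_right, hc.metric_frame_left] at h1
    have h2 : (fun q => metric e q (frame e j q) (frame e k q)) =
        fun _ => if k = j then 1 else 0 := by
      funext q
      rw [hc.metric_frame_right, hc.apply_frame]
    rw [h2, mvfderiv_const, ← connForm_apply, ← connForm_apply] at h1
    have h3 : (0 : ℝ) = G k j i + G j k i := h1
    linarith
  have htor (k i j : Fin 5) : G k j i - G k i j = -structureCoeff a b c k i j := by
    have h1 := nabla.torsion_apply (hdiff i p) (hdiff j p)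
    rw [hn.torsion_free] at h1
    have h2 : nabla (frame e j) p (frame e i p) = nabla (frame e i) p (frame e j p) +
        VectorField.mlieBracket 𝓘(ℝ, H21) (frame e i) (frame e j) p := by
      have h3 : (0 : TN p) = nabla (frame e j) p (frame e i p) - nabla (frame e i) p (frame e j p)
        - VectorField.mlieBracket 𝓘(ℝ, H21) (frame e i) (frame e j) p := h1
      rw [sub_sub] at h3
      exact sub_eq_zero.1 h3.symm
    simp only [G, connForm_apply]
    rw [h2, apply_add₁, apply_frame_mlieBracket hc he.leftInvariant, he.d_frame]
    ring
  have hG (k j i : Fin 5) : G k j i = lcCoeff a b c k j i := by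
    simp only [lcCoeff]
    linarith [htor k i j, htor i j k, htor j k i, hskew k j i, hskew k i j, hskew i j k]
  conv_lhs => rw [hc.eq_sum p X]
  rw [apply_sum₁, lcForm_apply]
  refine Finset.sum_congr rfl fun i _ => ?_
  rw [← hG k j i]
  ring

theorem IsCoframe.torsion_eq_zero (he : IsCoframe e) (hl : ∀ i, IsLeftInvariant (e i).pull)
    {nabla : NConnection} (h : ∀ i j p, nabla (frame e j) p (frame e i p) -
      nabla (frame e i) p (frame e j p) =
        VectorField.mlieBracket 𝓘(ℝ, H21) (frame e i) (frame e j) p) : nabla.torsion = 0 := by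
  funext p
  have h1 (i j : Fin 5) : nabla.torsion p (frame e i p) (frame e j p) = 0 := by
    rw [nabla.torsion_apply (he.diffAt_frame hl i p) (he.diffAt_frame hl j p), h, sub_self]
  ext u v
  change nabla.torsion p u v = 0
  rw [he.eq_sum p u, he.eq_sum p v]
  simp only [map_sum, map_smul, FunLike.coe_sum, Finset.sum_apply,
    FunLike.coe_smul, Pi.smul_apply, h1, smul_zero, Finset.sum_const_zero]

theorem mvfderiv_sum_mul {ι : Type*} (s : Finset ι) {f g : ι → N21 → ℝ} {p : N21}
    (hf : ∀ i, MDifferentiableAt 𝓘(ℝ, H21) 𝓘(ℝ, ℝ) (f i) p)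
    (hg : ∀ i, MDifferentiableAt 𝓘(ℝ, H21) 𝓘(ℝ, ℝ) (g i) p) (X : TN p) :
    MDifferentiableAt 𝓘(ℝ, H21) 𝓘(ℝ, ℝ) (∑ i ∈ s, f i * g i) p ∧
    mvfderiv 𝓘(ℝ, H21) (∑ i ∈ s, f i * g i) p X =
      ∑ i ∈ s, (f i p * mvfderiv 𝓘(ℝ, H21) (g i) p X +
        g i p * mvfderiv 𝓘(ℝ, H21) (f i) p X) := by
  classical
  induction s using Finset.induction_on with
  | empty =>
    simp only [Finset.sum_empty, mvfderiv_zero]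
    exact ⟨mdifferentiableAt_const, rfl⟩
  | insert i s hi ih =>
    have hm : MDifferentiableAt 𝓘(ℝ, H21) 𝓘(ℝ, ℝ) (f i * g i) p := (hf i).mul (hg i)
    simp only [Finset.sum_insert hi]
    refine ⟨hm.add ih.1, ?_⟩
    rw [mvfderiv_add hm ih.1, add_apply, ih.2, mvfderiv_mul (hf i) (hg i)]
    rfl

/-- Skew-symmetry of `lcForm` gives compatibility, and `lcCoeff_sub` gives vanishing torsion on the
frame, which suffices because torsion is a tensor. -/
theorem IsNilCoframe.isLeviCivita_connOf (he : IsNilCoframe a b c e) :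
    IsLeviCivita e (connOf he.isCoframe he.leftInvariant (lcForm a b c e)) where
  compatible p Y Z hY hZ X := by
    have hY' (i : Fin 5) := hY.mdifferentiableAt_apply (he.leftInvariant i)
    have hZ' (i : Fin 5) := hZ.mdifferentiableAt_apply (he.leftInvariant i)
    have h1 : mvfderiv 𝓘(ℝ, H21) (fun q => metric e q (Y q) (Z q)) p X =
        ∑ i, (e i p ![Y p] * mvfderiv 𝓘(ℝ, H21) (fun q => e i q ![Z q]) p X +
          e i p ![Z p] * mvfderiv 𝓘(ℝ, H21) (fun q => e i q ![Y q]) p X) := by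
      have hf : (fun q => metric e q (Y q) (Z q)) =
          ∑ i, (fun q => e i q ![Y q]) * fun q => e i q ![Z q] := by
        funext q
        simp [metric]
      rw [hf]
      exact (mvfderiv_sum_mul Finset.univ hY' hZ' X).2
    have h2 (W : VField) (i : Fin 5) :
        e i p ![connOf he.isCoframe he.leftInvariant (lcForm a b c e) W p X] = _ :=
      he.isCoframe.apply_connFun (lcForm a b c e) W p X i
    have h3 (i j : Fin 5) : lcForm a b c e i j p ![X] = -lcForm a b c e j i p ![X] := by
      rw [lcForm_apply, lcForm_apply, ← Finset.sum_neg_distrib]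
      exact Finset.sum_congr rfl fun k _ => by rw [lcCoeff_skew]; ring
    rw [h1]
    simp only [metric, h2, add_mul, mul_add, Finset.sum_add_distrib]
    have h4 : ∑ i, (∑ j, e j p ![Y p] * lcForm a b c e i j p ![X]) * e i p ![Z p] =
        -∑ i, e i p ![Y p] * ∑ j, e j p ![Z p] * lcForm a b c e i j p ![X] := by
      simp only [Finset.sum_mul, Finset.mul_sum, ← Finset.sum_neg_distrib]
      rw [Finset.sum_comm]
      refine Finset.sum_congr rfl fun i _ => Finset.sum_congr rfl fun j _ => ?_
      rw [h3 j i]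
      ring
    have h5 (f g : Fin 5 → ℝ) : ∑ i, f i * g i = ∑ i, g i * f i :=
      Finset.sum_congr rfl fun i _ => mul_comm _ _
    rw [h4, h5 fun i => e i p ![Z p]]
    ring
  torsion_free := by
    apply he.isCoframe.torsion_eq_zero he.leftInvariant
    intro i j p
    apply he.isCoframe.ext
    intro k
    rw [sub_eq_add_neg, ← neg_one_smul ℝ, apply_add₁, apply_smul₁, ← connForm_apply,
      ← connForm_apply, connForm_connOf, connForm_connOf,
      apply_frame_mlieBracket he.isCoframe he.leftInvariant, he.d_frame, ← lcCoeff_sub,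
      lcForm_apply, lcForm_apply]
    simp only [he.isCoframe.apply_frame, mul_ite, mul_one, mul_zero, Finset.sum_ite_eq',
      Finset.mem_univ, if_true]
    ring

end HeisNil
end

noncomputable section

namespace HeisNil

/-! ## Curvature and the first Pontrjagin forms -/

variable {a b c : ℝ} {e : Fin 5 → NForm 1}

theorem curvForm_apply (θ : Fin 5 → Fin 5 → NForm 1) (i j : Fin 5) (p : N21) (u v : TN p) :
    curvForm θ i j p ![u, v] = (θ i j).d p ![u, v] +
      ∑ k, (θ i k p ![u] * θ k j p ![v] - θ i k p ![v] * θ k j p ![u]) := by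
  simp only [← wedge_apply₁₁, curvForm, Pi.add_apply, Finset.sum_apply,
    ContinuousAlternatingMap.add_apply, ContinuousAlternatingMap.sum_apply]
  rfl

/-- All connection forms are multiples of `e^5`, so the quadratic terms contain `e^5 ∧ e^5 = 0`. -/
theorem IsNilCoframe.curvForm_instanton (he : IsNilCoframe a b c e) (s : Fin 5 → Fin 5 → ℝ) :
    curvForm (fun i j => s i j • e 4) = fun i j => s i j • (e 4).d := by
  funext i j
  apply ext₂
  intro p u v
  rw [curvForm_apply, d_smul (he.leftInvariant 4)]
  have h (k : Fin 5) : (s i k • e 4) p ![u] * (s k j • e 4) p ![v] -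
      (s i k • e 4) p ![v] * (s k j • e 4) p ![u] = 0 := by
    change s i k * e 4 p ![u] * (s k j * e 4 p ![v]) -
      s i k * e 4 p ![v] * (s k j * e 4 p ![u]) = 0
    ring
  simp only [h, Finset.sum_const_zero, add_zero]

theorem IsNilCoframe.d_lcForm (he : IsNilCoframe a b c e) (i j : Fin 5) :
    (lcForm a b c e i j).d = lcCoeff a b c i j 4 • (e 4).d := by
  unfold lcForm
  rw [d_sum_smul he.leftInvariant, Finset.sum_eq_single 4]
  · intro k _ hk
    rw [he.d_horizontal k hk, smul_zero]
  · simp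

/-- The volume form of `ℍ`. -/
def volH (e : Fin 5 → NForm 1) : NForm 4 := (e₂ e 0 1).wedge (e₂ e 2 3)

/-- The curvature coefficients of the Levi-Civita connection on horizontal vectors. -/
def lcCurvCoeff (B : Matrix (Fin 5) (Fin 5) ℝ) (i j k l : Fin 5) : ℝ :=
  -(1 / 2) * B i j * B k l - 1 / 4 * (B i k * B j l - B i l * B j k)

/-- The factor is twice the Pfaffian of the horizontal components. With it, both Pontrjagin forms
become sums of Pfaffians. -/
theorem horizontal_wedge_self {β : NForm 2} {q : Fin 5 → Fin 5 → ℝ}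
    (h : β = q 0 1 • e₂ e 0 1 + q 0 2 • e₂ e 0 2 + q 0 3 • e₂ e 0 3 + q 1 2 • e₂ e 1 2
      + q 1 3 • e₂ e 1 3 + q 2 3 • e₂ e 2 3) :
    β.wedge β = (2 * (q 0 1 * q 2 3 - q 0 2 * q 1 3 + q 0 3 * q 1 2)) • volH e := by
  have hβ (p : N21) (u v : TN p) : β p ![u, v] = q 0 1 * e₂ e 0 1 p ![u, v]
      + q 0 2 * e₂ e 0 2 p ![u, v] + q 0 3 * e₂ e 0 3 p ![u, v] + q 1 2 * e₂ e 1 2 p ![u, v]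
      + q 1 3 * e₂ e 1 3 p ![u, v] + q 2 3 * e₂ e 2 3 p ![u, v] := by
    rw [h]; rfl
  apply ext₄
  intro p u v w x
  have hv : ((2 * (q 0 1 * q 2 3 - q 0 2 * q 1 3 + q 0 3 * q 1 2)) • volH e) p ![u, v, w, x] =
      2 * (q 0 1 * q 2 3 - q 0 2 * q 1 3 + q 0 3 * q 1 2) * volH e p ![u, v, w, x] := rfl
  rw [hv]
  simp only [volH, NForm.wedge_eval, wedge_apply₂₂, hβ, e₂_apply]
  ring

theorem IsNilCoframe.dη_wedge_dη (he : IsNilCoframe a b c e) :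
    (e 4).d.wedge (e 4).d = (-2 * (a ^ 2 + b ^ 2 + c ^ 2)) • volH e := by
  have h := horizontal_wedge_self (e := e) (β := (e 4).d) (q := dηMatrix a b c) (by
    rw [he.d_vertical]
    simp [dηMatrix]
    module)
  refine h.trans ?_
  congr 1
  simp [dηMatrix]
  ring

/-- The differential of the connection form contributes `-½ B_ij dη`. Among the quadratic terms the
horizontal `k` give `e^5 ∧ e^5 = 0`, and the index of `e^5` gives the term with factor `1/4`. -/
theorem IsNilCoframe.curvForm_lcForm (he : IsNilCoframe a b c e) {i j : Fin 5} (hi : i ≠ 4)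
    (hj : j ≠ 4) {q : Fin 5 → Fin 5 → ℝ} (hq : q = lcCurvCoeff (dηMatrix a b c) i j) :
    curvForm (lcForm a b c e) i j = q 0 1 • e₂ e 0 1 + q 0 2 • e₂ e 0 2 + q 0 3 • e₂ e 0 3
      + q 1 2 • e₂ e 1 2 + q 1 3 • e₂ e 1 3 + q 2 3 • e₂ e 2 3 := by
  subst hq
  apply ext₂
  intro p u v
  rw [curvForm_apply, he.d_lcForm]
  have h1 : (lcCoeff a b c i j 4 • (e 4).d) p ![u, v] =
    lcCoeff a b c i j 4 * (e 4).d p ![u, v] := rfl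
  rw [h1, dη_apply he.d_vertical]
  have h2 (q : Fin 5 → Fin 5 → ℝ) : (q 0 1 • e₂ e 0 1 + q 0 2 • e₂ e 0 2 + q 0 3 • e₂ e 0 3
      + q 1 2 • e₂ e 1 2 + q 1 3 • e₂ e 1 3 + q 2 3 • e₂ e 2 3) p ![u, v] =
      q 0 1 * e₂ e 0 1 p ![u, v]
      + q 0 2 * e₂ e 0 2 p ![u, v] + q 0 3 * e₂ e 0 3 p ![u, v] + q 1 2 * e₂ e 1 2 p ![u, v]
      + q 1 3 * e₂ e 1 3 p ![u, v] + q 2 3 * e₂ e 2 3 p ![u, v] := rfl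
  rw [h2]
  simp only [lcForm_apply, e₂_apply, Fin.sum_univ_five]
  fin_cases i <;> fin_cases j <;> first | exact absurd rfl hi | exact absurd rfl hj | skip
  all_goals
    simp [lcCoeff, structureCoeff, lcCurvCoeff, dηMatrix]
    ring

/-- The quadratic terms produce `B Bᵀ`, which is `a² + b² + c²` times the identity on `ℍ`. The
result is decomposable and so drops out of the Pontrjagin form. -/
theorem IsNilCoframe.curvForm_lcForm_vertical (he : IsNilCoframe a b c e) {i : Fin 5}
    (hi : i ≠ 4) : curvForm (lcForm a b c e) i 4 =
      (-(1 / 4) * (a ^ 2 + b ^ 2 + c ^ 2)) • (e 4).wedge (e i) := by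
  apply ext₂
  intro p u v
  rw [curvForm_apply, he.d_lcForm]
  have h1 : (lcCoeff a b c i 4 4 • (e 4).d) p ![u, v] =
    lcCoeff a b c i 4 4 * (e 4).d p ![u, v] := rfl
  have h2 : ((-(1 / 4) * (a ^ 2 + b ^ 2 + c ^ 2)) • (e 4).wedge (e i)) p ![u, v] =
    -(1 / 4) * (a ^ 2 + b ^ 2 + c ^ 2) * ((e 4 p ![u] * e i p ![v] - e 4 p ![v] * e i p ![u])) := by
    rw [← wedge_apply₁₁]; rfl
  rw [h1, h2, dη_apply he.d_vertical]
  simp only [lcForm_apply, Fin.sum_univ_five]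
  fin_cases i <;> first | exact absurd rfl hi | skip
  all_goals
    simp [lcCoeff, structureCoeff, dηMatrix]
    ring

theorem smul_wedge_smul (r s : ℝ) (α β : NForm 2) :
    (r • α).wedge (s • β) = (r * s) • α.wedge β := by
  apply ext₄
  intro p u v w x
  have h1 (t : ℝ) (γ : NForm 2) (y z : TN p) : (t • γ) p ![y, z] = t * γ p ![y, z] := rfl
  have h2 : ((r * s) • α.wedge β) p ![u, v, w, x] = r * s * (α.wedge β) p ![u, v, w, x] := rfl
  rw [h2]
  simp only [NForm.wedge_eval, wedge_apply₂₂, h1]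
  ring

theorem wedge_wedge_self (α β : NForm 1) : (α.wedge β).wedge (α.wedge β) = 0 := by
  apply ext₄
  intro p u v w x
  change _ = (0 : ℝ)
  simp only [NForm.wedge_eval, wedge_apply₂₂, wedge_apply₁₁]
  ring

theorem sum_Ioi_five {M : Type*} [AddCommMonoid M] (f : Fin 5 → Fin 5 → M) :
    ∑ i : Fin 5, ∑ j ∈ Finset.Ioi i, f i j =
      f 0 1 + f 0 2 + f 0 3 + f 0 4 + (f 1 2 + f 1 3 + f 1 4) + (f 2 3 + f 2 4) + f 3 4 := by
  have h0 : Finset.Ioi (0 : Fin 5) = {1, 2, 3, 4} := by decide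
  have h1 : Finset.Ioi (1 : Fin 5) = {2, 3, 4} := by decide
  have h2 : Finset.Ioi (2 : Fin 5) = {3, 4} := by decide
  have h3 : Finset.Ioi (3 : Fin 5) = {4} := by decide
  have h4 : Finset.Ioi (4 : Fin 5) = ∅ := by decide
  rw [Fin.sum_univ_five, h0, h1, h2, h3, h4]
  simp [add_assoc]

theorem IsNilCoframe.pontrjagin_lcForm (he : IsNilCoframe a b c e) :
    pontrjagin (lcForm a b c e) =
      (1 / (8 * Real.pi ^ 2) * (-(3 / 2) * (a ^ 2 + b ^ 2 + c ^ 2) ^ 2)) • volH e := by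
  unfold pontrjagin
  rw [sum_Ioi_five, mul_smul]
  congr 1
  have hv (i : Fin 5) (hi : i ≠ 4) : (curvForm (lcForm a b c e) i 4).wedge
      (curvForm (lcForm a b c e) i 4) = 0 := by
    rw [he.curvForm_lcForm_vertical hi, smul_wedge_smul, wedge_wedge_self, smul_zero]
  have hh (i j : Fin 5) (hi : i ≠ 4) (hj : j ≠ 4) :=
    horizontal_wedge_self (he.curvForm_lcForm hi hj rfl)
  rw [hv 0 (by decide), hv 1 (by decide), hv 2 (by decide), hv 3 (by decide),
    hh 0 1 (by decide) (by decide), hh 0 2 (by decide) (by decide), hh 0 3 (by decide) (by decide),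
    hh 1 2 (by decide) (by decide), hh 1 3 (by decide) (by decide), hh 2 3 (by decide) (by decide)]
  simp only [add_zero, ← add_smul]
  congr 1
  simp [lcCurvCoeff, dηMatrix]
  ring

theorem IsNilCoframe.pontrjagin_instanton (he : IsNilCoframe a b c e) (l m t : ℝ) :
    pontrjagin (fun i j => instantonCoeff l m t i j • e 4) =
      (1 / (8 * Real.pi ^ 2) * (-4 * (l ^ 2 + m ^ 2 + t ^ 2) * (a ^ 2 + b ^ 2 + c ^ 2))) •
        volH e := by
  unfold pontrjagin
  rw [sum_Ioi_five, mul_smul]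
  congr 1
  have hc (i j : Fin 5) : curvForm (fun i j => instantonCoeff l m t i j • e 4) i j =
      instantonCoeff l m t i j • (e 4).d :=
    congrFun (congrFun (he.curvForm_instanton (instantonCoeff l m t)) i) j
  simp only [hc, smul_wedge_smul, he.dη_wedge_dη, smul_smul, ← add_smul]
  congr 1
  simp [instantonCoeff]
  ring

theorem IsNilCoframe.anomaly (he : IsNilCoframe a b c e) {l m t : ℝ}
    (h : 0 < 3 * (a ^ 2 + b ^ 2 + c ^ 2) - 8 * (l ^ 2 + m ^ 2 + t ^ 2)) :
    (torsion₃ e).d =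
      (2 * Real.pi ^ 2 * (16 / (3 * (a ^ 2 + b ^ 2 + c ^ 2) - 8 * (l ^ 2 + m ^ 2 + t ^ 2)))) •
        (pontrjagin (lcForm a b c e) - pontrjagin (fun i j => instantonCoeff l m t i j • e 4)) := by
  rw [he.pontrjagin_lcForm, he.pontrjagin_instanton, he.d_torsion, he.dη_wedge_dη]
  refine Eq.trans ?_ (congrArg _ (sub_smul _ _ (volH e)))
  rw [smul_smul]
  congr 1
  have hpi := Real.pi_ne_zero
  generalize a ^ 2 + b ^ 2 + c ^ 2 = r at *
  generalize l ^ 2 + m ^ 2 + t ^ 2 = s at *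
  obtain ⟨d, hd⟩ : ∃ d, 3 * r - 8 * s = d := ⟨_, rfl⟩
  -- Eliminating `s` makes the denominator the single variable `d`, known to be nonzero.
  obtain rfl : s = (3 * r - d) / 8 := by linarith
  rw [hd] at h ⊢
  have hne := ne_of_gt h
  field_simp
  ring

end HeisNil
end

noncomputable section

namespace HeisNil

/-! ## The parallel spinor -/

variable {a b c : ℝ} {e : Fin 5 → NForm 1}

theorem plusForm_apply (θ : Fin 5 → Fin 5 → NForm 1) (T : NForm 3) (i j : Fin 5) (p : N21)
    (X : TN p) : plusForm e θ T i j p ![X] =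
      θ i j p ![X] + 1 / 2 * T p ![X, frame e j p, frame e i p] := by
  have h : Function.update ![0, frame e j p, frame e i p] 0 X = ![X, frame e j p, frame e i p] := by
    funext k
    fin_cases k <;> rfl
  rw [← h]
  rfl

theorem IsNilCoframe.dη_frame (he : IsNilCoframe a b c e) (p : N21) (i j : Fin 5) :
    (e 4).d p ![frame e i p, frame e j p] = dηMatrix a b c i j := by
  rw [dη_apply he.d_vertical]
  simp only [he.isCoframe.apply_frame]
  fin_cases i <;> fin_cases j <;> simp [dηMatrix]

theorem IsNilCoframe.dη_frame_right (he : IsNilCoframe a b c e) (p : N21) (X : TN p) (j : Fin 5) :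
    (e 4).d p ![X, frame e j p] = ∑ i, dηMatrix a b c i j * e i p ![X] := by
  rw [dη_apply he.d_vertical]
  simp only [he.isCoframe.apply_frame, Fin.sum_univ_five]
  fin_cases j <;> simp [dηMatrix] <;> ring

/-- The torsion term doubles the purely horizontal Levi-Civita forms and cancels those involving the
index of `e^5`. What is left takes values in the anti-self-dual `su(2)`, which fixes the spinor. -/
theorem IsNilCoframe.plusForm_lcForm (he : IsNilCoframe a b c e) (i j : Fin 5) (p : N21)
    (X : TN p) : plusForm e (lcForm a b c e) (torsion₃ e) i j p ![X] =
      -dηMatrix a b c i j * e 4 p ![X] := by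
  rw [plusForm_apply, torsion_apply, lcForm_apply, he.dη_frame, he.dη_frame_right,
    he.dη_frame_right, he.isCoframe.apply_frame, he.isCoframe.apply_frame]
  simp only [Fin.sum_univ_five]
  fin_cases i <;> fin_cases j <;> simp [lcCoeff, structureCoeff, dηMatrix] <;> ring

/-- The constant spinor which is parallel for `∇^+`. -/
def parallelSpinor : Spinor := fun _ => Pi.single 0 1

theorem γ_four_single : (γ 4).mulVec (Pi.single 0 1) = Complex.I • (Pi.single 0 1 : Fin 4 → ℂ) := by
  funext k
  fin_cases k <;> simp [γ]

/-- Anti-self-dual 2-forms annihilate the parallel spinor. -/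
theorem sum_dηMatrix_smul (a b c : ℝ) :
    ∑ i, ∑ j, ((dηMatrix a b c i j : ℝ) : ℂ) • (γ i * γ j).mulVec (Pi.single 0 1) = 0 := by
  funext k
  simp only [Finset.sum_apply, Fin.sum_univ_five, Pi.zero_apply]
  fin_cases k <;> simp [γ, dηMatrix]

/-- `T = η ∧ dη` puts `E_5` in one of three slots. In each case the product reduces to `dη · ε = 0`:
`E_5` already stands on the left, or anticommutes past a horizontal vector, or acts first on `ε` as
`√-1`. -/
theorem IsNilCoframe.cliff₃_torsion (he : IsNilCoframe a b c e) (p : N21) :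
    (cliff₃ e (torsion₃ e) p).mulVec (Pi.single 0 1) = 0 := by
  have hT (i j k : Fin 5) : torsion₃ e p ![frame e i p, frame e j p, frame e k p] =
      (if i = 4 then dηMatrix a b c j k else 0) - (if j = 4 then dηMatrix a b c i k else 0)
        + (if k = 4 then dηMatrix a b c i j else 0) := by
    rw [torsion_apply]
    simp only [he.dη_frame, he.isCoframe.apply_frame, eq_comm (a := (4 : Fin 5)), ite_mul,
      one_mul, zero_mul]
  have h := sum_dηMatrix_smul a b c
  have h1 (i k : Fin 5) : ((dηMatrix a b c i k : ℝ) : ℂ) •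
      (γ i * γ 4 * γ k).mulVec (Pi.single 0 1) = -((dηMatrix a b c i k : ℝ) : ℂ) •
        (γ 4).mulVec ((γ i * γ k).mulVec (Pi.single 0 1)) := by
    by_cases hi : i = 4
    · subst hi
      have : dηMatrix a b c 4 k = 0 := by fin_cases k <;> simp [dηMatrix]
      simp [this]
    · have hc := γ_clifford i 4
      rw [if_neg hi] at hc
      rw [eq_neg_of_add_eq_zero_left hc, Matrix.neg_mul, Matrix.neg_mulVec, smul_neg, neg_smul,
        Matrix.mulVec_mulVec, Matrix.mul_assoc]
  have hA (M : Matrix (Fin 4) (Fin 4) ℂ) (c : ℂ) (v : Fin 4 → ℂ) :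
      c • M.mulVec v = M.mulVec (c • v) := (Matrix.mulVec_smul M c v).symm
  simp only [cliff₃, Matrix.smul_mulVec, Matrix.sum_mulVec]
  simp only [hT, Complex.ofReal_add, Complex.ofReal_sub, apply_ite Complex.ofReal, Complex.ofReal_zero, add_smul, sub_smul,
    ite_smul, zero_smul, Finset.sum_add_distrib, Finset.sum_sub_distrib]
  have e1 : ∑ i, ∑ j, ∑ k, (if i = 4 then ((dηMatrix a b c j k : ℝ) : ℂ) •
      (γ i * γ j * γ k).mulVec (Pi.single 0 1) else 0) = 0 := by
    rw [Finset.sum_eq_single 4 (fun i _ hi => by simp [hi]) (by simp)]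
    simp only [if_true, Matrix.mul_assoc, ← Matrix.mulVec_mulVec _ (γ 4), hA (γ 4),
      ← Matrix.mulVec_sum, h, Matrix.mulVec_zero]
  have e2 : ∑ i, ∑ j, ∑ k, (if j = 4 then ((dηMatrix a b c i k : ℝ) : ℂ) •
      (γ i * γ j * γ k).mulVec (Pi.single 0 1) else 0) = 0 := by
    rw [Finset.sum_comm, Finset.sum_eq_single 4 (fun i _ hi => by simp [hi]) (by simp)]
    simp only [if_true, h1, neg_smul, Finset.sum_neg_distrib, hA (γ 4),
      ← Matrix.mulVec_sum, h, Matrix.mulVec_zero, neg_zero]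
  have e3 : ∑ i, ∑ j, ∑ k, (if k = 4 then ((dηMatrix a b c i j : ℝ) : ℂ) •
      (γ i * γ j * γ k).mulVec (Pi.single 0 1) else 0) = 0 := by
    simp only [Finset.sum_ite_eq', Finset.mem_univ, if_true, ← Matrix.mulVec_mulVec _ (γ _ * γ _),
      γ_four_single, Matrix.mulVec_smul, smul_comm _ Complex.I, ← Finset.smul_sum, h, smul_zero]
  rw [e1, e2, e3]
  simp

theorem defines_parallelSpinor (he : IsCoframe e) : DefinesStructure e parallelSpinor where
  reeb _ := γ_four_single
  endo p X := by
    obtain ⟨h0, h1, h2, h3, h4⟩ := he.ψ_coord p X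
    funext k
    simp only [cliffVec, h0, h1, h2, h3, h4, parallelSpinor, Fin.sum_univ_five]
    fin_cases k <;> simp [γ] <;> ring_nf <;> simp <;> ring

/-- The spinor and the dilaton are constant, so no derivatives survive, and every equation comes
down to `sum_dηMatrix_smul`. -/
theorem IsNilCoframe.isSupersymmetric (he : IsNilCoframe a b c e) (φ₀ : ℝ)
    (s : Fin 5 → Fin 5 → ℝ) : IsSupersymmetric e (plusForm e (lcForm a b c e) (torsion₃ e))
      (torsion₃ e) (fun _ => φ₀) (fun i j => s i j • (e 4).d) parallelSpinor where
  smooth := contMDiff_const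
  ne_zero p h := by simpa [parallelSpinor] using congrFun h 0
  gravitino p X := by
    have h := sum_dηMatrix_smul a b c
    have hd : mvfderiv 𝓘(ℝ, H21) parallelSpinor p X = 0 := by
      unfold parallelSpinor
      rw [mvfderiv_const]; rfl
    rw [spinDeriv, hd, zero_add]
    have hs (i j : Fin 5) : plusForm e (lcForm a b c e) (torsion₃ e) j i p ![X] =
        e 4 p ![X] * dηMatrix a b c i j := by
      rw [he.plusForm_lcForm, dηMatrix_skew a b c i j]
      ring
    simp only [hs, parallelSpinor, Complex.ofReal_mul, mul_smul, ← Finset.smul_sum, h, smul_zero]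
  dilatino p := by
    have h : cliff₁ e (oneForm (mvfderiv 𝓘(ℝ, H21) fun _ => φ₀)) p = 0 := by
      refine Finset.sum_eq_zero fun i _ => ?_
      have : oneForm (mvfderiv 𝓘(ℝ, H21) fun _ : N21 => φ₀) p ![frame e i p] = 0 := by
        change mvfderiv 𝓘(ℝ, H21) (fun _ : N21 => φ₀) p (frame e i p) = 0
        rw [mvfderiv_const]; rfl
      rw [this, Complex.ofReal_zero, zero_smul]
    rw [h, zero_sub, Matrix.neg_mulVec, Matrix.smul_mulVec, parallelSpinor, he.cliff₃_torsion,
      smul_zero, neg_zero]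
  gaugino i j p := by
    have h := sum_dηMatrix_smul a b c
    have hs (u v : TN p) : (s i j • (e 4).d) p ![u, v] = s i j * (e 4).d p ![u, v] := rfl
    simp only [cliff₂, hs, he.dη_frame, parallelSpinor, Matrix.smul_mulVec, Matrix.sum_mulVec,
      Complex.ofReal_mul, mul_smul, ← Finset.smul_sum, h, smul_zero]

end HeisNil
end

noncomputable section

namespace HeisNil

/-! ## Compactness of `N(2,1)` -/

theorem exists_latticeΓ_mul_mem_Icc (h : H21) :
    ∃ γ : latticeΓ, ∀ i, ((γ : H21) * h) i ∈ Set.Icc (0 : ℝ) 1 := by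
  have hf (x y : ℝ) (hxy : -(⌊x⌋ : ℝ) + x = y) : y ∈ Set.Icc (0 : ℝ) 1 := by
    rw [← hxy]
    constructor
    · linarith [Int.floor_le x]
    · linarith [Int.lt_floor_add_one x]
  -- Left multiplication by `g` also shifts the last coordinate by `g 0 * h 2 + g 1 * h 3`, so its
  -- floor is taken after this shift.
  let g : H21 := !₂[-(⌊h 0⌋ : ℝ), -(⌊h 1⌋ : ℝ), -(⌊h 2⌋ : ℝ), -(⌊h 3⌋ : ℝ),
    -(⌊h 4 + -(⌊h 0⌋ : ℝ) * h 2 + -(⌊h 1⌋ : ℝ) * h 3⌋ : ℝ)]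
  have hg : g ∈ latticeΓ := by
    intro i
    fin_cases i
    exacts [⟨-⌊h 0⌋, by simp [g]⟩, ⟨-⌊h 1⌋, by simp [g]⟩, ⟨-⌊h 2⌋, by simp [g]⟩,
      ⟨-⌊h 3⌋, by simp [g]⟩, ⟨-⌊h 4 + -(⌊h 0⌋ : ℝ) * h 2 + -(⌊h 1⌋ : ℝ) * h 3⌋, by simp [g]⟩]
  refine ⟨⟨g, hg⟩, fun i => ?_⟩
  fin_cases i
  · exact hf (h 0) _ (by simp [g, mul_def])
  · exact hf (h 1) _ (by simp [g, mul_def])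
  · exact hf (h 2) _ (by simp [g, mul_def])
  · exact hf (h 3) _ (by simp [g, mul_def])
  · refine hf (h 4 + -(⌊h 0⌋ : ℝ) * h 2 + -(⌊h 1⌋ : ℝ) * h 3) _ ?_
    simp only [g, mul_def]
    simp
    ring

instance : CompactSpace N21 := by
  have hK : IsCompact ((EuclideanSpace.equiv (Fin 5) ℝ).symm ''
      Set.pi Set.univ fun _ => Set.Icc (0 : ℝ) 1) :=
    (isCompact_univ_pi fun _ => isCompact_Icc).image (ContinuousLinearEquiv.continuous _)
  refine ⟨?_⟩
  convert hK.image continuous_proj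
  refine (Set.eq_univ_of_forall fun p => ?_).symm
  obtain ⟨h, rfl⟩ := proj_surjective p
  obtain ⟨γ, hγ⟩ := exists_latticeΓ_mul_mem_Icc h
  exact ⟨(γ : H21) * h, ⟨EuclideanSpace.equiv (Fin 5) ℝ ((γ : H21) * h), fun i _ => hγ i,
    ContinuousLinearEquiv.symm_apply_apply _ _⟩, proj_mul γ h⟩

/-! ## The explicit coframe -/

/-- A left-invariant form is in particular `Γ`-invariant, so it descends: transport it from one
chosen point of each fibre, and compare with the other points by `pull_mul_left`. -/
theorem IsLeftInvariant.exists_pull_eq {k : ℕ} {θ : H21 → H21 [⋀^Fin k]→L[ℝ] ℝ}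
    (hθ : IsLeftInvariant θ) : ∃ α : NForm k, α.pull = θ := by
  -- The property of `β` is phrased through global forms `α`, which avoids a cast between `TN p` and
  -- `TN (proj h)`.
  have hex (p : N21) : ∃ β : TN p [⋀^Fin k]→L[ℝ] ℝ, ∃ h, proj h = p ∧
      ∀ α : NForm k, α p = β → α.pull h = θ h := by
    obtain ⟨h, rfl⟩ := proj_surjective p
    refine ⟨(θ h).compContinuousLinearMap ((projD h).symm : TN (proj h) →L[ℝ] H21), h, rfl,
      fun α hα => ?_⟩
    ext v
    rw [pull_apply, hα]
    simp [Function.comp_def]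
  choose α hα using hex
  refine ⟨α, funext fun h' => ?_⟩
  obtain ⟨h, hh, hα'⟩ := hα (proj h')
  obtain ⟨γ, rfl⟩ := (proj_eq_iff _ _).1 hh.symm
  have h1 := pull_mul_left α γ h
  rw [hα' α rfl, ← isLeftInvariant_iff.1 hθ γ h] at h1
  ext v
  have h2 := DFunLike.congr_fun h1 fun i => leftD (γ : H21)⁻¹ (v i)
  have h3 (w : H21) : leftD (γ : H21) (leftD (γ : H21)⁻¹ w) = w :=
    DFunLike.congr_fun (leftD_comp_inv (γ : H21)) w
  simpa [h3, Function.comp_def] using h2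

theorem dcoord_apply (i : Fin 5) (v : Fin 1 → H21) : dcoord i v = v 0 i := rfl

variable {a b c : ℝ}

theorem explicitCoframe_apply_of_ne (hab : a ^ 2 + b ^ 2 ≠ 0) (i : Fin 5) (h v : H21) :
    explicitCoframe a b c i h ![v] =
      ![(a ^ 2 + b ^ 2 + c ^ 2) * v 0,
        a * v 2 + b * (1 + c ^ 2 / (a ^ 2 + b ^ 2)) * v 1 - a * c * v 3,
        b * v 2 - a * (1 + c ^ 2 / (a ^ 2 + b ^ 2)) * v 1 - b * c * v 3,
        c * v 2 + (a ^ 2 + b ^ 2) * v 3,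
        (a ^ 2 + b ^ 2 + c ^ 2) ^ 2 * (h 0 * v 2 + h 1 * v 3 - v 4)] i := by
  rw [explicitCoframe, if_pos hab]
  fin_cases i <;> simp [dcoord_apply]

theorem explicitCoframe_apply_of_eq (hab : a ^ 2 + b ^ 2 = 0) (i : Fin 5) (h v : H21) :
    explicitCoframe a b c i h ![v] =
      ![v 0, v 1, -v 3, v 2, c * (h 0 * v 2 + h 1 * v 3 - v 4)] i := by
  rw [explicitCoframe, if_neg (not_not.2 hab)]
  fin_cases i <;> simp [dcoord_apply]

theorem isLeftInvariant_explicitCoframe (a b c : ℝ) (i : Fin 5) :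
    IsLeftInvariant (explicitCoframe a b c i) := by
  rw [isLeftInvariant_iff]
  intro g h
  ext v
  rw [vec₁ v]
  have hv : (fun j => leftD g (![v 0] j)) = ![leftD g (v 0)] := by
    funext j; fin_cases j; rfl
  change explicitCoframe a b c i (g * h) (fun j => leftD g (![v 0] j)) = _
  rw [hv]
  by_cases hab : a ^ 2 + b ^ 2 = 0
  · rw [explicitCoframe_apply_of_eq hab, explicitCoframe_apply_of_eq hab]
    fin_cases i <;> simp [leftD_apply, mul_def]
    exact Or.inl (by ring)
  · rw [explicitCoframe_apply_of_ne hab, explicitCoframe_apply_of_ne hab]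
    fin_cases i <;> simp [leftD_apply, mul_def]
    exact Or.inl (by ring)

theorem explicitCoframe_apply_injective (habc : a ^ 2 + b ^ 2 + c ^ 2 ≠ 0) {h v : H21}
    (hv : ∀ i, explicitCoframe a b c i h ![v] = 0) : v = 0 := by
  by_cases hab : a ^ 2 + b ^ 2 = 0
  · have hc : c ≠ 0 := by
      rintro rfl
      exact habc (by linarith)
    simp only [explicitCoframe_apply_of_eq hab] at hv
    have h0 : v 0 = 0 := by simpa using hv 0
    have h1 : v 1 = 0 := by simpa using hv 1
    have h2 : v 2 = 0 := by simpa using hv 3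
    have h3 : v 3 = 0 := by simpa using hv 2
    have h4 : v 4 = 0 := by simpa [h2, h3, hc] using hv 4
    ext i
    fin_cases i <;> assumption
  · simp only [explicitCoframe_apply_of_ne hab] at hv
    have h0 : v 0 = 0 := by simpa [habc] using hv 0
    have k1 : a * v 2 + b * (1 + c ^ 2 / (a ^ 2 + b ^ 2)) * v 1 - a * c * v 3 = 0 := hv 1
    have k2 : b * v 2 - a * (1 + c ^ 2 / (a ^ 2 + b ^ 2)) * v 1 - b * c * v 3 = 0 := hv 2
    have k3 : c * v 2 + (a ^ 2 + b ^ 2) * v 3 = 0 := hv 3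
    -- The combination `b k1 - a k2` eliminates `v 2` and `v 3`; then `a k1 + b k2` isolates `v 2 -
    -- c * v 3`, and `k3` separates the two.
    have h1 : v 1 = 0 := by
      have : (a ^ 2 + b ^ 2 + c ^ 2) * v 1 = 0 := by
        have h5 : (a ^ 2 + b ^ 2) * (1 + c ^ 2 / (a ^ 2 + b ^ 2)) = a ^ 2 + b ^ 2 + c ^ 2 := by
          field_simp
        linear_combination b * k1 - a * k2 - v 1 * h5
      exact (mul_eq_zero.1 this).resolve_left habc
    have h23 : v 2 - c * v 3 = 0 := by
      have : (a ^ 2 + b ^ 2) * (v 2 - c * v 3) = 0 := by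
        linear_combination a * k1 + b * k2
      exact (mul_eq_zero.1 this).resolve_left hab
    have h3 : v 3 = 0 := by
      have : (a ^ 2 + b ^ 2 + c ^ 2) * v 3 = 0 := by linear_combination k3 - c * h23
      exact (mul_eq_zero.1 this).resolve_left habc
    have h2 : v 2 = 0 := by linear_combination h23 + c * h3
    have h4 : v 4 = 0 := by simpa [h2, h3, habc] using hv 4
    ext i
    fin_cases i <;> assumption

theorem isCoframe_of_pull_eq_explicitCoframe (habc : a ^ 2 + b ^ 2 + c ^ 2 ≠ 0)
    {e : Fin 5 → NForm 1} (he : ∀ i, (e i).pull = explicitCoframe a b c i) : IsCoframe e := by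
  intro p
  obtain ⟨h, rfl⟩ := proj_surjective p
  let f : H21 →ₗ[ℝ] (Fin 5 → ℝ) := LinearMap.pi fun i => lin₁ (explicitCoframe a b c i h)
  have hinj : Function.Injective f := by
    rw [← LinearMap.ker_eq_bot, LinearMap.ker_eq_bot']
    intro v hv
    exact explicitCoframe_apply_injective habc fun i => congrFun hv i
  have hbij : Function.Bijective f :=
    ⟨hinj, (LinearMap.injective_iff_surjective_of_finrank_eq_finrank (by simp)).1 hinj⟩
  convert hbij.comp (projD h).symm.bijective using 1
  funext v i
  have h1 : (fun j => (projD h).symm (![v] j)) = ![(projD h).symm v] := by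
    funext j; fin_cases j; rfl
  rw [pull_symm_apply, he i, h1]
  rfl

theorem exists_isNilCoframe (habc : a ^ 2 + b ^ 2 + c ^ 2 ≠ 0) :
    ∃ e : Fin 5 → NForm 1, IsNilCoframe a b c e ∧
      ∀ i h, (e i).pull h = explicitCoframe a b c i h := by
  choose e he using fun i => (isLeftInvariant_explicitCoframe a b c i).exists_pull_eq
  have hl (i : Fin 5) : IsLeftInvariant (e i).pull := by
    rw [he]
    exact isLeftInvariant_explicitCoframe a b c i
  have hap (i : Fin 5) (u : TN basePoint) : e i basePoint ![u] =
      explicitCoframe a b c i 1 ![(projD 1).symm u] := by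
    have h1 : (fun j => (projD 1).symm (![u] j)) = ![(projD 1).symm u] := by
      funext j; fin_cases j; rfl
    rw [← he i, ← h1]
    exact pull_symm_apply (e i) 1 ![u]
  have hbr (u v : TN basePoint) : (projD 1).symm (tbracket u v) =
      bracket ((projD 1).symm u) ((projD 1).symm v) := by
    simp [tbracket]
  refine ⟨e, ⟨isCoframe_of_pull_eq_explicitCoframe habc he, hl, fun i hi => ?_, ?_⟩,
    fun i h => congrFun (he i) h⟩
  · apply NForm.ext_of_isLeftInvariant (isLeftInvariant_pull_d (hl i)) IsLeftInvariant.zero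
    ext w
    rw [vec₂ w, d_apply₁ (hl i), hap, hbr]
    change _ = (0 : ℝ)
    by_cases hab : a ^ 2 + b ^ 2 = 0
    · rw [explicitCoframe_apply_of_eq hab]
      fin_cases i <;> simp [bracket] at hi ⊢
    · rw [explicitCoframe_apply_of_ne hab]
      fin_cases i <;> simp [bracket] at hi ⊢
  · apply NForm.ext_of_isLeftInvariant (isLeftInvariant_pull_d (hl 4))
    · exact ((((isLeftInvariant_e₂ hl 0 1).sub (isLeftInvariant_e₂ hl 2 3)).smul a).add
        (((isLeftInvariant_e₂ hl 0 2).add (isLeftInvariant_e₂ hl 1 3)).smul b)).add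
        (((isLeftInvariant_e₂ hl 0 3).sub (isLeftInvariant_e₂ hl 1 2)).smul c)
    ext w
    rw [vec₂ w, d_apply₁ (hl 4), hap, hbr]
    change _ = a * (e₂ e 0 1 basePoint ![w 0, w 1] - e₂ e 2 3 basePoint ![w 0, w 1])
      + b * (e₂ e 0 2 basePoint ![w 0, w 1] + e₂ e 1 3 basePoint ![w 0, w 1])
      + c * (e₂ e 0 3 basePoint ![w 0, w 1] - e₂ e 1 2 basePoint ![w 0, w 1])
    simp only [e₂_apply, hap]
    generalize (projD 1).symm (w 0) = u
    generalize (projD 1).symm (w 1) = v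
    by_cases hab : a ^ 2 + b ^ 2 = 0
    · have ha : a = 0 := by nlinarith [sq_nonneg a, sq_nonneg b]
      have hb : b = 0 := by nlinarith [sq_nonneg a, sq_nonneg b]
      simp only [explicitCoframe_apply_of_eq hab]
      simp [bracket, ha, hb]
      ring
    · simp only [explicitCoframe_apply_of_ne hab]
      simp [bracket]
      field_simp
      ring

end HeisNil
end

/-! ### The main theorem -/

theorem proposition4p4 (a b c l m t : ℝ) (hpos : 0 < l ^ 2 + m ^ 2 + t ^ 2)
    (hlt : l ^ 2 + m ^ 2 + t ^ 2 < 3 / 8 * (a ^ 2 + b ^ 2 + c ^ 2)) :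
    -- `N(2,1)` is compact, and the explicit left-invariant coframe descends to it
    CompactSpace N21 ∧
    (∃ e : Fin 5 → NForm 1, IsNilCoframe a b c e ∧
      ∀ i h, (e i).pull h = explicitCoframe a b c i h) ∧
    ∀ e : Fin 5 → NForm 1, IsNilCoframe a b c e →
      -- the `SU(2)`-structure, the Levi-Civita connection and the connection `A` exist
      IsSU2Structure (η e) (F e) ∧
      (∃ nabla : NConnection, IsLeviCivita e nabla) ∧
      (∃ A : NConnection, IsInstantonA e l m t A) ∧
      ∀ nabla A : NConnection, IsLeviCivita e nabla → IsInstantonA e l m t A →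
        ∀ α' φ₀ : ℝ,
          α' = 16 / (3 * (a ^ 2 + b ^ 2 + c ^ 2) - 8 * (l ^ 2 + m ^ 2 + t ^ 2)) →
          -- anomaly cancellation with respect to the Levi-Civita connection
          0 < α' ∧
          (torsion₃ e).d = (2 * Real.pi ^ 2 * α') •
            (pontrjagin (connForm e nabla) - pontrjagin (connForm e A)) ∧
          -- the structure equations, the instanton condition and the non-vanishing flux
          (∀ i, (F e i).d = 0) ∧
          hodgeH e (η e).d = -(η e).d ∧
          IsSU2Instanton e (curvForm (connForm e A)) ∧
          torsion₃ e ≠ 0 ∧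
          -- the supersymmetry equations, with constant dilaton
          ∃ ε : Spinor, DefinesStructure e ε ∧
            IsSupersymmetric e (plusForm e (connForm e nabla) (torsion₃ e)) (torsion₃ e)
              (fun _ => φ₀) (curvForm (connForm e A)) ε := by
  have hD : 0 < 3 * (a ^ 2 + b ^ 2 + c ^ 2) - 8 * (l ^ 2 + m ^ 2 + t ^ 2) := by linarith
  have habc : a ^ 2 + b ^ 2 + c ^ 2 ≠ 0 := by
    have : 0 < a ^ 2 + b ^ 2 + c ^ 2 := by linarith
    exact this.ne'
  refine ⟨inferInstance, exists_isNilCoframe habc, fun e he => ?_⟩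
  refine ⟨he.isCoframe.isSU2Structure, ⟨_, he.isLeviCivita_connOf⟩,
    ⟨connOf he.isCoframe he.leftInvariant fun i j => instantonCoeff l m t i j • e 4,
      fun i j => connForm_connOf he.isCoframe he.leftInvariant _ i j⟩, ?_⟩
  intro nabla A hnabla hA α' φ₀ hα
  have hA' : connForm e A = fun i j => instantonCoeff l m t i j • e 4 :=
    funext fun i => funext fun j => hA i j
  have hΩ := he.curvForm_instanton (instantonCoeff l m t)
  -- The two connections enter the remaining claims only through their connection forms, which are
  -- now explicit.
  rw [hA', he.connForm_eq_lcForm hnabla]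
  refine ⟨hα ▸ div_pos (by norm_num) hD, hα ▸ he.anomaly hD, he.d_F, he.hodgeH_dη,
    (congrArg (IsSU2Instanton e) hΩ).mpr (he.isSU2Instanton _), he.torsion_ne_zero habc,
    parallelSpinor, defines_parallelSpinor he.isCoframe, ?_⟩
  have h := he.isSupersymmetric φ₀ (instantonCoeff l m t)
  rwa [← hΩ] at h
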